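/- \textbf{Setting.} Let $\mathcal E$ be three-dimensional Euclidean space and $\mathcal L$ the four-dimensional smooth manifold of oriented straight lines of $\mathcal E$; a line is identified with the pair $(u,q)$ of its unit directing vector $u$ and the orthogonal projection $q\perp u$ of the origin on it, so that $\mathcal L\cong T^*S^2$. A \emph{two-parameter family of rays} is a smooth immersion $L:M\to\mathcal L$ of a smooth two-dimensional manifold $M$ (in particular, any two-dimensional immersed submanifold of $\mathcal L$). A point $m_0\in L(k_0)$ is \emph{regular} on the ray $L(k_0)$ if for every smooth surface $S\subset\mathcal E$ containing $m_0$ and transverse to $L(k_0)$ at $m_0$ there are open neighbourhoods $U$ of $k_0$ in $M$ and $V$ of $m_0$ in $S$ such that each $L(k)$, $k\in U$, meets $V$ at a unique point $m(k)$ and $k\mapsto m(k)$ is a diffeomorphism of $U$ onto $V$. The family is \emph{rectangular} if for each $k_0\in M$ and each regular point $m_0$ of $L(k_0)$ there is a smooth surface containing $m_0$ which is orthogonally crossed by $L(k)$ for all $k$ in a neighbourhood of $k_0$. Light passes successively through homogeneous isotropic media with refractive indices $n_0,\dots,n_N>0$ and meets successively smooth surfaces $S_1,\dots,S_N$ ($N\ge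 0$ arbitrary), each of which either reflects or refracts it ($n_i=n_{i-1}$ if $S_i$ reflects). A family $L_0:M\to\mathcal L$ \emph{enters the system and becomes successively} $L_1,\dots,L_N:M\to\mathcal L$ if, for $1\le i\le N$, there is a continuous map $P_i:M\to\mathcal E$ with $P_i(k)\in S_i\cap L_{i-1}(k)\cap L_i(k)$ for all $k$ such that the unit directing vectors $u,u'$ of $L_{i-1}(k),L_i(k)$ and a unit normal $\nu$ of $S_i$ at $P_i(k)$ satisfy \begin{itemize} \item if $S_i$ reflects: $u\cdot\nu\ne0$ and $u'=u-2(u\cdot\nu)\nu$; \item if $S_i$ refracts: $(u\cdot\nu)(u'\cdot\nu)>0$ and $n_i\bigl(u'-(u'\cdot\nu)\nu\bigr)=n_{i-1}\bigl(u-(u\cdot\nu)\nu\bigr)$. \end{itemize} \textbf{Theorem (Malus--Dupin).} Let $L_0:M\to\mathcal L$ be a rectangular two-parameter family of rays, each ray of which carries at least one regular point, and suppose that it enters an optical system as above and becomes successively $L_1,\dots,L_N$. Then, for every $i\in\{0,\dots,N\}$, $L_i$ is a two-parameter family of rays, each of its rays carries at least one regular point, and $L_i$ is rectangular. -/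

import Mathlib

open scoped Manifold ContDiff InnerProductSpace Topology

namespace MalusDupin

/-- The physical space, a three-dimensional Euclidean space, with an origin chosen. -/
abbrev Space : Type := EuclideanSpace ℝ (Fin 3)

/-! ### Oriented straight lines -/

/-- An oriented straight line, given by its unit directing vector `dir` and by the orthogonal
projection `foot` of the origin on it. The pairs `(dir, foot)` form the total space of the tangent
(or, through the scalar product, cotangent) bundle of the unit sphere, realised as a closed
four-dimensional submanifold of `Space × Space`. -/
@[ext]
structure OrientedLine where
  dir : Space
  foot : Space
  norm_dir : ‖dir‖ = 1
  foot_orth : ⟪foot, dir⟫_ℝ = 0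

namespace OrientedLine

/-- The points of an oriented line. -/
def points (L : OrientedLine) : Set Space := {x | ∃ t : ℝ, x = L.foot + t • L.dir}

/-- The coordinates `(dir, foot)` of an oriented line. They embed the manifold of oriented lines as
a submanifold of `Space × Space`, so a map into the manifold of oriented lines is smooth
(an immersion) iff its composition with `coords` is. -/
def coords (L : OrientedLine) : Space × Space := (L.dir, L.foot)

/-- The oriented line through `p` with unit directing vector `u`. -/
noncomputable def through (p u : Space) (hu : ‖u‖ = 1) : OrientedLine where
  dir := u
  foot := p - ⟪p, u⟫_ℝ • u
  norm_dir := hu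
  foot_orth := by
    rw [inner_sub_left, real_inner_smul_left, real_inner_self_eq_norm_sq, hu]; ring

theorem mem_points_through (p u : Space) (hu : ‖u‖ = 1) : p ∈ (through p u hu).points :=
  ⟨⟪p, u⟫_ℝ, by simp [through]⟩

/-- An oriented line is determined by its direction and any one of its points. -/
theorem eq_through (L : OrientedLine) (p : Space) (hp : p ∈ L.points) :
    L = through p L.dir L.norm_dir := by
  obtain ⟨t, rfl⟩ := hp
  ext1
  · rfl
  · simp only [through]
    rw [inner_add_left, real_inner_smul_left, real_inner_self_eq_norm_sq, L.norm_dir, L.foot_orth]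
    simp

end OrientedLine

/-! ### Smooth surfaces -/

/-- `f` is a smooth local equation, with non-zero differential, of `S` near `x`. -/
def IsLocalEquation (S : Set Space) (x : Space) (f : Space → ℝ) : Prop :=
  ∃ W : Set Space, IsOpen W ∧ x ∈ W ∧ ContDiffOn ℝ ∞ f W ∧ fderiv ℝ f x ≠ 0 ∧
    ∀ y ∈ W, y ∈ S ↔ f y = 0

/-- Smooth (embedded, without boundary, not necessarily closed or connected) surfaces in space. -/
def IsSmoothSurface (S : Set Space) : Prop :=
  ∀ x ∈ S, ∃ f : Space → ℝ, IsLocalEquation S x f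

/-- The tangent plane of a surface `S` at `x`: the velocities at `x` of curves drawn on `S`. -/
def tangentPlane (S : Set Space) (x : Space) : Set Space :=
  {v | ∃ γ : ℝ → Space, γ 0 = x ∧ (∀ᶠ t in 𝓝 (0 : ℝ), γ t ∈ S) ∧ HasDerivAt γ v 0}

/-- `n` is a unit vector orthogonal to `S` at `x`. -/
def IsUnitNormal (S : Set Space) (x n : Space) : Prop :=
  ‖n‖ = 1 ∧ ∀ v ∈ tangentPlane S x, ⟪n, v⟫_ℝ = 0

/-- The oriented line `L` crosses the surface `S`, and does so orthogonally. -/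
def CrossesOrthogonally (L : OrientedLine) (S : Set Space) : Prop :=
  (L.points ∩ S).Nonempty ∧
    ∀ x ∈ L.points ∩ S, ∀ v ∈ tangentPlane S x, ⟪L.dir, v⟫_ℝ = 0

/-! ### Families of rays -/

section Families

variable {M : Type*} [TopologicalSpace M]

/-- A family of rays smoothly depending on `n` parameters: a smooth immersion of an
`n`-dimensional smooth manifold `M` in the manifold of oriented lines. -/
def IsRayFamily (n : ℕ) [ChartedSpace (EuclideanSpace ℝ (Fin n)) M] (L : M → OrientedLine) : Prop :=
  ContMDiff (𝓡 n) 𝓘(ℝ, Space × Space) ∞ (fun k => (L k).coords) ∧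
    ∀ k : M, Function.Injective (mfderiv (𝓡 n) 𝓘(ℝ, Space × Space) (fun k => (L k).coords) k)

/-- `x` is a regular point of the ray `L k` in the two-parameter family `L`: for every smooth
surface `S` containing `x` and transverse to `L k` at `x`, there are an open neighbourhood `U`
(the source of `e`) of `k` in the family and an open neighbourhood `V` (the target of `e`) of `x`
in `S`, such that each ray in `U` meets `V` at a unique point, and the map which sends the ray to
that point is a diffeomorphism of `U` onto `V`. -/
def IsRegularPoint [ChartedSpace (EuclideanSpace ℝ (Fin 2)) M] (L : M → OrientedLine) (k : M)
    (x : Space) : Prop :=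
  x ∈ (L k).points ∧
    ∀ S : Set Space, IsSmoothSurface S → x ∈ S → (L k).dir ∉ tangentPlane S x →
      ∃ e : PartialEquiv M Space,
        IsOpen e.source ∧ k ∈ e.source ∧
        (∃ W : Set Space, IsOpen W ∧ e.target = S ∩ W) ∧ x ∈ e.target ∧
        (∀ l ∈ e.source, (L l).points ∩ e.target = {e l}) ∧
        ContMDiffOn (𝓡 2) 𝓘(ℝ, Space) ∞ e e.source ∧
        ContMDiffOn 𝓘(ℝ, Space) (𝓡 2) ∞ e.symm e.target

/-- A two-parameter family is rectangular when, for each regular point `x` of each ray `L k`, there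
is a smooth surface containing `x` and orthogonally crossed by all rays in a neighbourhood of
`L k` in the family. -/
def IsRectangular [ChartedSpace (EuclideanSpace ℝ (Fin 2)) M] (L : M → OrientedLine) : Prop :=
  ∀ (k : M) (x : Space), IsRegularPoint L k x →
    ∃ S : Set Space, IsSmoothSurface S ∧ x ∈ S ∧ ∀ᶠ l in 𝓝 k, CrossesOrthogonally (L l) S

end Families

/-! ### Optical systems -/

/-- The law of reflection, for a ray with direction `u₁` transverse to the mirror, the reflected
direction `u₂` and the unit normal `n` of the mirror. -/
def ReflectionLaw (n u₁ u₂ : Space) : Prop :=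
  ⟪u₁, n⟫_ℝ ≠ 0 ∧ u₂ = u₁ - (2 * ⟪u₁, n⟫_ℝ) • n

/-- The Snell-Descartes law of refraction, from a medium with index `n₁` to a medium with index
`n₂`, for the unit normal `n` of the surface: the products of the indices with the tangential parts
of the directions agree, and both rays cross the surface transversally in the same sense. -/
def RefractionLaw (n₁ n₂ : ℝ) (n u₁ u₂ : Space) : Prop :=
  0 < ⟪u₁, n⟫_ℝ * ⟪u₂, n⟫_ℝ ∧
    n₂ • (u₂ - ⟪u₂, n⟫_ℝ • n) = n₁ • (u₁ - ⟪u₁, n⟫_ℝ • n)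

/-- The two ways in which a surface can act on the light. -/
inductive SurfaceKind
  | reflecting
  | refracting

/-- An optical system, listed along the path of the light: the `N` successive smooth surfaces which
the light meets, and the refractive indices of the `N + 1` successive homogeneous isotropic media
in which it propagates. Light stays in the same medium at a reflecting surface. A surface which is
met several times is listed as many times. -/
structure OpticalSystem (N : ℕ) where
  surface : Fin N → Set Space
  smooth_surface : ∀ i, IsSmoothSurface (surface i)
  kind : Fin N → SurfaceKind
  index : Fin (N + 1) → ℝ
  index_pos : ∀ i, 0 < index i
  index_reflecting : ∀ i, kind i = SurfaceKind.reflecting → index i.succ = index i.castSucc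

/-- The law which relates the directions of the light before and after its `i`-th encounter with a
surface, where `n` is the unit normal of the surface. -/
def OpticalSystem.Law {N : ℕ} (sys : OpticalSystem N) (i : Fin N) (n u₁ u₂ : Space) : Prop :=
  match sys.kind i with
  | SurfaceKind.reflecting => ReflectionLaw n u₁ u₂
  | SurfaceKind.refracting => RefractionLaw (sys.index i.castSucc) (sys.index i.succ) n u₁ u₂

/-- The family of rays `ray 0` enters the optical system and successively becomes the families
`ray 1, …, ray N`: in the `i`-th medium the light with parameter `k` is borne by the oriented line
`ray i k`, which hits the next surface at the point `hit i k`, where it is reflected or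
refracted. Neighbouring rays hit the surface at neighbouring points. -/
structure Propagates {M : Type*} [TopologicalSpace M] {N : ℕ} (sys : OpticalSystem N)
    (ray : Fin (N + 1) → M → OrientedLine) (hit : Fin N → M → Space) : Prop where
  continuous_hit : ∀ i, Continuous (hit i)
  hit_mem_surface : ∀ i k, hit i k ∈ sys.surface i
  hit_mem_incoming : ∀ i k, hit i k ∈ (ray i.castSucc k).points
  hit_mem_outgoing : ∀ i k, hit i k ∈ (ray i.succ k).points
  law : ∀ i k, ∃ n : Space, IsUnitNormal (sys.surface i) (hit i k) n ∧
    sys.Law i n (ray i.castSucc k).dir (ray i.succ k).dir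

end MalusDupin

/-! Write the rays locally as `u z` (direction) and `q z` (foot). A front `q + τ u` is orthogonal to
the rays exactly when `dτ = -⟪dq, u⟫`; a local solution `τ` is a potential (`HasPotential`), and
this condition no longer mentions any point of the ray.

At one surface, let `P` be the hitting point, `s = ⟪P, u⟫` and `s' = ⟪P, u'⟫` its abscissas. Both
optical laws say that `n₂ u' - n₁ u` is normal to the surface, while `dP` is tangent to it, so `n₂
⟪dP, u'⟫ = n₁ ⟪dP, u⟫`. Hence `τ' = s' - (n₁ / n₂) (s - τ)` is a potential of the outgoing rays: the
optical length `n₁ (s - τ) + n₂ (τ' - s')` between the fronts is constant. The same step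
(`SmoothRays.deviate`) preserves smoothness and immersivity.

It remains to translate. Regular points are the non-focal ones, where `(z, t) ↦ q + t u` is a local
diffeomorphism (`IsRegularPoint.nonfocal`, `Nonfocal.isRegularPoint`). Rectangularity at one regular
point of each ray gives a potential; conversely a potential gives a front through every non-focal
point (`SmoothRays.exists_wavefront`). Finally, a potential makes the family Lagrangian, and an
immersed Lagrangian family has a non-focal point on each ray (`SmoothRays.exists_nonfocal`). -/

namespace MalusDupin

/-! ### Smooth functions near a point and the implicit function theorem -/

/-- `f` is smooth in a neighbourhood of `x`. -/
def SmoothNear {E F : Type*} [NormedAddCommGroup E] [NormedSpace ℝ E] [NormedAddCommGroup F]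
    [NormedSpace ℝ F] (f : E → F) (x : E) : Prop :=
  ∀ᶠ y in 𝓝 x, ContDiffAt ℝ ∞ f y

section SmoothNear

variable {E F G : Type*} [NormedAddCommGroup E] [NormedSpace ℝ E] [NormedAddCommGroup F]
    [NormedSpace ℝ F] [NormedAddCommGroup G] [NormedSpace ℝ G]

theorem SmoothNear.contDiffAt {f : E → F} {x : E} (h : SmoothNear f x) : ContDiffAt ℝ ∞ f x :=
  h.self_of_nhds

theorem SmoothNear.congr {f g : E → F} {x : E} (h : SmoothNear f x) (hg : g =ᶠ[𝓝 x] f) :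
    SmoothNear g x := by
  filter_upwards [h, hg.eventually_nhds] with y hy hgy
  exact hy.congr_of_eventuallyEq hgy

theorem SmoothNear.comp {g : F → G} {f : E → F} {x : E} (hg : SmoothNear g (f x))
    (hf : SmoothNear f x) : SmoothNear (fun y => g (f y)) x := by
  filter_upwards [hf, hf.contDiffAt.continuousAt.eventually hg] with y hy hgy
  exact hgy.comp y hy

theorem smoothNear_of_contDiff {f : E → F} (h : ContDiff ℝ ∞ f) (x : E) : SmoothNear f x :=
  Filter.Eventually.of_forall fun _ => h.contDiffAt

theorem SmoothNear.add {f g : E → F} {x : E} (hf : SmoothNear f x) (hg : SmoothNear g x) :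
    SmoothNear (fun y => f y + g y) x := by
  filter_upwards [hf, hg] with y h₁ h₂ using h₁.add h₂

theorem SmoothNear.sub {f g : E → F} {x : E} (hf : SmoothNear f x) (hg : SmoothNear g x) :
    SmoothNear (fun y => f y - g y) x := by
  filter_upwards [hf, hg] with y h₁ h₂ using h₁.sub h₂

theorem SmoothNear.smul {f : E → ℝ} {g : E → F} {x : E} (hf : SmoothNear f x)
    (hg : SmoothNear g x) : SmoothNear (fun y => f y • g y) x := by
  filter_upwards [hf, hg] with y h₁ h₂ using h₁.smul h₂

theorem SmoothNear.mul {f g : E → ℝ} {x : E} (hf : SmoothNear f x)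
    (hg : SmoothNear g x) : SmoothNear (fun y => f y * g y) x := by
  filter_upwards [hf, hg] with y h₁ h₂ using h₁.mul h₂

theorem SmoothNear.inner {f g : E → Space} {x : E} (hf : SmoothNear f x)
    (hg : SmoothNear g x) : SmoothNear (fun y => ⟪f y, g y⟫_ℝ) x := by
  filter_upwards [hf, hg] with y h₁ h₂ using h₁.inner ℝ h₂

theorem smoothNear_const (c : F) (x : E) : SmoothNear (fun _ => c) x :=
  smoothNear_of_contDiff contDiff_const x

theorem SmoothNear.sqrt {f : E → ℝ} {x : E} (hf : SmoothNear f x) (h0 : f x ≠ 0) :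
    SmoothNear (fun y => √(f y)) x := by
  filter_upwards [hf, hf.contDiffAt.continuousAt.eventually_ne h0] with y h₁ h₂ using h₁.sqrt h₂

theorem SmoothNear.inv {f : E → ℝ} {x : E} (hf : SmoothNear f x) (h0 : f x ≠ 0) :
    SmoothNear (fun y => (f y)⁻¹) x := by
  filter_upwards [hf, hf.contDiffAt.continuousAt.eventually_ne h0] with y h₁ h₂ using h₁.inv h₂

theorem SmoothNear.fderiv {f : E → F} {x : E} (hf : SmoothNear f x) :
    SmoothNear (fderiv ℝ f) x := by
  filter_upwards [hf] with y hy using hy.fderiv_right (m := ∞) (by simp)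

theorem SmoothNear.differentiableAt {f : E → F} {x : E} (hf : SmoothNear f x) :
    DifferentiableAt ℝ f x :=
  hf.contDiffAt.differentiableAt (by simp)

theorem SmoothNear.continuousAt {f : E → F} {x : E} (hf : SmoothNear f x) :
    ContinuousAt f x :=
  hf.contDiffAt.continuousAt

theorem isInvertible_comp_inr {A : E × ℝ →L[ℝ] ℝ} (h : A (0, 1) ≠ 0) :
    (A ∘L .inr ℝ E ℝ).IsInvertible := by
  refine ⟨ContinuousLinearEquiv.unitsEquivAut ℝ (Units.mk0 _ h), ?_⟩
  ext
  simp

/-- The implicit function theorem for a scalar unknown. -/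
theorem exists_implicit [CompleteSpace E] {h : E × ℝ → ℝ} {z₀ : E} {t₀ : ℝ}
    (hs : SmoothNear h (z₀, t₀)) (h0 : h (z₀, t₀) = 0) (hd : fderiv ℝ h (z₀, t₀) (0, 1) ≠ 0) :
    ∃ τ : E → ℝ, SmoothNear τ z₀ ∧ τ z₀ = t₀ ∧ ∀ᶠ p in 𝓝 (z₀, t₀), h p = 0 ↔ τ p.1 = p.2 := by
  have key : ∀ p : E × ℝ, ContDiffAt ℝ ∞ h p → h p = 0 → fderiv ℝ h p (0, 1) ≠ 0 →
      ∃ τ : E → ℝ, ContDiffAt ℝ ∞ τ p.1 ∧ τ p.1 = p.2 ∧ ∀ᶠ q in 𝓝 p, h q = 0 ↔ τ q.1 = q.2 := by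
    intro p hc hp hd
    have hi := isInvertible_comp_inr hd
    refine ⟨hc.implicitFunction (by simp) hi, hc.contDiffAt_implicitFunction _ hi,
      hc.implicitFunction_apply_self _ hi, ?_⟩
    filter_upwards [hc.eventually_apply_eq_iff_implicitFunction (by simp) hi] with q hq
    rw [← hq, hp]
  obtain ⟨τ, hτ, hτ0, hiff⟩ := key _ hs.contDiffAt h0 hd
  simp only at hτ hτ0
  refine ⟨τ, ?_, hτ0, hiff⟩
  have hτ1 : ∀ᶠ z in 𝓝 z₀, ContDiffAt ℝ 1 τ z := (hτ.of_le (by simp)).eventually (by simp)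
  have hcont : Filter.Tendsto (fun z => (z, τ z)) (𝓝 z₀) (𝓝 (z₀, t₀)) := by
    have := (continuousAt_id (x := z₀)).prodMk hτ.continuousAt
    simpa [ContinuousAt, hτ0] using this
  have hd' : ∀ᶠ p in 𝓝 (z₀, t₀), fderiv ℝ h p (0, 1) ≠ 0 :=
    (hs.fderiv.continuousAt.clm_apply continuousAt_const).eventually_ne hd
  -- `ContDiffAt ℝ ∞` at `z₀` does not pass to neighbours, since the neighbourhood may shrink with
  -- the order. So the theorem is applied again at each nearby `(z, τ z)`; local uniqueness
  -- identifies the new solution `σ` with `τ`.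
  filter_upwards [hτ1, hcont.eventually (hs.and (hd'.and hiff.eventually_nhds))]
    with z hz ⟨hz1, hz2, hz3⟩
  obtain ⟨σ, hσ, hσ0, hσiff⟩ := key _ hz1 (hz3.self_of_nhds.2 rfl) hz2
  refine hσ.congr_of_eventuallyEq ?_
  have hc : Filter.Tendsto (fun y => (y, τ y)) (𝓝 z) (𝓝 (z, τ z)) :=
    (continuousAt_id (x := z)).prodMk hz.continuousAt
  filter_upwards [hc.eventually (hz3.and hσiff)] with y hy
  exact ((hy.2.1 (hy.1.2 rfl))).symm

end SmoothNear

/-! ### Tangent planes and normals of surfaces -/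

theorem IsLocalEquation.smoothNear {S : Set Space} {x : Space} {f : Space → ℝ}
    (h : IsLocalEquation S x f) : SmoothNear f x := by
  obtain ⟨W, hW, hx, hf, -, -⟩ := h
  filter_upwards [hW.mem_nhds hx] with y hy using hf.contDiffAt (hW.mem_nhds hy)

theorem IsLocalEquation.eventually_iff {S : Set Space} {x : Space} {f : Space → ℝ}
    (h : IsLocalEquation S x f) : ∀ᶠ y in 𝓝 x, y ∈ S ↔ f y = 0 := by
  obtain ⟨W, hW, hx, -, -, hS⟩ := h
  filter_upwards [hW.mem_nhds hx] with y hy using hS y hy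

theorem IsLocalEquation.eventually {S : Set Space} {x : Space} {f : Space → ℝ}
    (h : IsLocalEquation S x f) : ∀ᶠ y in 𝓝 x, IsLocalEquation S y f := by
  have hs := h.smoothNear.fderiv.continuousAt
  obtain ⟨W, hW, hx, hf, hd, hS⟩ := h
  filter_upwards [hW.mem_nhds hx, hs.eventually_ne hd] with y hy hdy
  exact ⟨W, hW, hy, hf, hdy, hS⟩

theorem IsLocalEquation.fderiv_ne_zero {S : Set Space} {x : Space} {f : Space → ℝ}
    (h : IsLocalEquation S x f) : fderiv ℝ f x ≠ 0 := h.choose_spec.2.2.2.1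

/-- One inclusion is the chain rule. For the other, the implicit function parametrises the level set
by the kernel of `df`, and the image of the line `t • v` is a curve on `S` with velocity `v`. -/
theorem IsLocalEquation.mem_tangentPlane_iff {S : Set Space} {x : Space} {f : Space → ℝ}
    (h : IsLocalEquation S x f) (hx : x ∈ S) (v : Space) :
    v ∈ tangentPlane S x ↔ fderiv ℝ f x v = 0 := by
  have hfx : f x = 0 := h.eventually_iff.self_of_nhds.1 hx
  have hfd := h.smoothNear.differentiableAt
  constructor
  · rintro ⟨γ, hγ0, hγS, hγ⟩
    subst hγ0
    have h1 : HasDerivAt (fun t => f (γ t)) (fderiv ℝ f (γ 0) v) 0 :=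
      hfd.hasFDerivAt.comp_hasDerivAt (0 : ℝ) hγ
    have h2 : (fun t => f (γ t)) =ᶠ[𝓝 0] fun _ => (0 : ℝ) := by
      filter_upwards [hγS, hγ.continuousAt.eventually h.eventually_iff] with t h1 h2
      exact h2.1 h1
    exact h1.unique ((hasDerivAt_const (0 : ℝ) (0 : ℝ)).congr_of_eventuallyEq h2)
  · intro hv
    have hst : HasStrictFDerivAt f (fderiv ℝ f x) x :=
      h.smoothNear.contDiffAt.hasStrictFDerivAt (by simp)
    have hr : (fderiv ℝ f x : Space →ₗ[ℝ] ℝ).range = ⊤ := by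
      rw [LinearMap.range_eq_top]
      apply LinearMap.surjective
      intro h0
      exact h.fderiv_ne_zero (by ext w; exact DFunLike.congr_fun h0 w)
    let w : (fderiv ℝ f x : Space →ₗ[ℝ] ℝ).ker := ⟨v, hv⟩
    have hd := (hst.to_implicitFunction hr).hasFDerivAt
    have hlin : HasDerivAt (fun t : ℝ => t • w) w 0 := by
      simpa using (hasDerivAt_id (0 : ℝ)).smul_const w
    have hd' : HasFDerivAt (hst.implicitFunction f (fderiv ℝ f x) hr (f x))
      (fderiv ℝ f x : Space →ₗ[ℝ] ℝ).ker.subtypeL ((0 : ℝ) • w) := by simpa using hd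
    have hγ := hd'.comp_hasDerivAt (0 : ℝ) hlin
    have h00 : hst.implicitFunction f (fderiv ℝ f x) hr (f x) 0 = x :=
      hst.implicitFunction_apply_image hr
    refine ⟨_, ?_, ?_, hγ⟩
    · simp
    · have e1 := hst.map_implicitFunction_eq hr
      have c1 : Filter.Tendsto (fun t : ℝ => (f x, t • w)) (𝓝 0) (𝓝 (f x, 0)) := by
        have : ContinuousAt (fun t : ℝ => (f x, t • w)) 0 := by fun_prop
        simpa [ContinuousAt] using this
      have c2 := hγ.continuousAt
      simp only [ContinuousAt, Function.comp, zero_smul, h00] at c2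
      filter_upwards [c1.eventually e1, c2.eventually h.eventually_iff] with t h1 h2
      exact h2.2 (h1.trans hfx)

theorem fderiv_eq_inner_gradient (f : Space → ℝ) (x v : Space) :
    fderiv ℝ f x v = ⟪gradient f x, v⟫_ℝ := by
  simp [gradient]

theorem IsLocalEquation.gradient_ne_zero {S : Set Space} {x : Space} {f : Space → ℝ}
    (h : IsLocalEquation S x f) : gradient f x ≠ 0 := by
  intro h0
  apply h.fderiv_ne_zero
  ext1 v
  simp [fderiv_eq_inner_gradient, h0]

theorem SmoothNear.gradient {x : Space} {f : Space → ℝ} (h : SmoothNear f x) :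
    SmoothNear (gradient f) x := by
  filter_upwards [h.fderiv] with y hy
  exact ((InnerProductSpace.toDual ℝ Space).symm.contDiff.contDiffAt).comp y hy

/-- Removing from `n` its projection on the gradient leaves a tangent vector, orthogonal to `n` and
to the gradient, hence to itself. This replaces pointwise chosen normals, whose sign may jump, by a
smooth field. -/
theorem IsLocalEquation.unitNormal_eq {S : Set Space} {x n : Space} {f : Space → ℝ}
    (h : IsLocalEquation S x f) (hx : x ∈ S) (hn : IsUnitNormal S x n) :
    ∃ c : ℝ, c ≠ 0 ∧ n = c • gradient f x := by
  set g := gradient f x with hg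
  have hg0 : ⟪g, g⟫_ℝ ≠ 0 := inner_self_ne_zero.2 h.gradient_ne_zero
  set c := ⟪g, n⟫_ℝ / ⟪g, g⟫_ℝ with hc
  have h1 : ⟪g, n - c • g⟫_ℝ = 0 := by
    rw [inner_sub_right, real_inner_smul_right, hc]; field_simp; ring
  have h2 : ⟪n, n - c • g⟫_ℝ = 0 := by
    apply hn.2
    rw [h.mem_tangentPlane_iff hx, fderiv_eq_inner_gradient]; exact h1
  have h3 : ⟪n - c • g, n - c • g⟫_ℝ = 0 := by
    nth_rewrite 1 [inner_sub_left]
    rw [real_inner_smul_left, h1, h2]; simp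
  have h4 : n = c • g := sub_eq_zero.1 (inner_self_eq_zero.1 h3)
  refine ⟨c, ?_, h4⟩
  rintro h0
  have := hn.1
  rw [h4, h0] at this
  simp at this

/-! ### The parameter plane and the inverse function theorem -/

/-- The model space of the parameters of the rays. -/
abbrev Plane : Type := EuclideanSpace ℝ (Fin 2)

/-- Invertibility of the derivative is an open condition, so the source can be shrunk until the
inverse is smooth at every point of the target, not only at the image of `a`. -/
theorem exists_localDiffeo {E F : Type*} [NormedAddCommGroup E] [NormedSpace ℝ E]
    [NormedAddCommGroup F] [NormedSpace ℝ F] [CompleteSpace E] {f : E → F} {a : E}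
    (hf : SmoothNear f a) (e : E ≃L[ℝ] F) (he : fderiv ℝ f a = e) :
    ∃ Φ : OpenPartialHomeomorph E F, a ∈ Φ.source ∧ (∀ p, Φ p = f p) ∧
      (∀ p ∈ Φ.source, ContDiffAt ℝ ∞ f p) ∧ ∀ y ∈ Φ.target, ContDiffAt ℝ ∞ Φ.symm y := by
  have hd : HasFDerivAt f (e : E →L[ℝ] F) a := he ▸ hf.differentiableAt.hasFDerivAt
  have h1 : ∀ᶠ p in 𝓝 a, fderiv ℝ f p ∈ Set.range ((↑) : (E ≃L[ℝ] F) → E →L[ℝ] F) := by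
    apply hf.fderiv.continuousAt.eventually
    rw [he]
    exact ContinuousLinearEquiv.nhds e
  obtain ⟨O, hO, hOo, haO⟩ := eventually_nhds_iff.1 (hf.and h1)
  set Ψ := hf.contDiffAt.toOpenPartialHomeomorph f hd (by simp)
  have haΨ : a ∈ Ψ.source := hf.contDiffAt.mem_toOpenPartialHomeomorph_source hd (by simp)
  refine ⟨Ψ.restrOpen O hOo, ⟨haΨ, haO⟩, fun p => rfl, fun p hp => (hO p hp.2).1, fun y hy => ?_⟩
  have hys := (Ψ.restrOpen O hOo).map_target hy
  obtain ⟨e', he'⟩ := (hO _ hys.2).2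
  refine OpenPartialHomeomorph.contDiffAt_symm (f₀' := e') _ hy ?_ (hO _ hys.2).1
  rw [he']
  exact ((hO _ hys.2).1.differentiableAt (by simp)).hasFDerivAt

/-! ### Families of rays parametrised by the plane -/

namespace OrientedLine

theorem inner_dir_self (L : OrientedLine) : ⟪L.dir, L.dir⟫_ℝ = 1 := by
  rw [real_inner_self_eq_norm_sq, L.norm_dir]; norm_num

theorem dir_ne_zero (L : OrientedLine) : L.dir ≠ 0 := by
  intro h
  have := L.norm_dir
  simp [h] at this

theorem inner_point (L : OrientedLine) (t : ℝ) : ⟪L.foot + t • L.dir, L.dir⟫_ℝ = t := by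
  rw [inner_add_left, real_inner_smul_left, L.inner_dir_self, L.foot_orth]; ring

theorem eq_of_mem_points {L : OrientedLine} {x : Space} (h : x ∈ L.points) :
    x = L.foot + ⟪x, L.dir⟫_ℝ • L.dir := by
  obtain ⟨t, rfl⟩ := h
  rw [L.inner_point]

end OrientedLine

/-- The rays `ℓ z` depend smoothly on `z` in a neighbourhood of `z₀`. -/
structure SmoothRays (ℓ : Plane → OrientedLine) (z₀ : Plane) : Prop where
  dir : SmoothNear (fun z => (ℓ z).dir) z₀
  foot : SmoothNear (fun z => (ℓ z).foot) z₀

theorem SmoothRays.eventually {ℓ : Plane → OrientedLine} {z₀ : Plane} (h : SmoothRays ℓ z₀) :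
    ∀ᶠ z in 𝓝 z₀, SmoothRays ℓ z := by
  filter_upwards [h.dir.eventually_nhds, h.foot.eventually_nhds] with z h1 h2 using ⟨h1, h2⟩

/-- The derivative at `z` of the direction of the rays. -/
noncomputable def dirDeriv (ℓ : Plane → OrientedLine) (z : Plane) : Plane →L[ℝ] Space :=
  fderiv ℝ (fun z => (ℓ z).dir) z

/-- The derivative at `z` of the foot of the rays. -/
noncomputable def footDeriv (ℓ : Plane → OrientedLine) (z : Plane) : Plane →L[ℝ] Space :=
  fderiv ℝ (fun z => (ℓ z).foot) z

/-- The point of parameter `t` of the ray `ℓ z` is not a focal point of the family. -/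
def Nonfocal (ℓ : Plane → OrientedLine) (z : Plane) (t : ℝ) : Prop :=
  ∀ (v : Plane) (s : ℝ), footDeriv ℓ z v + t • dirDeriv ℓ z v + s • (ℓ z).dir = 0 → v = 0

/-- The rays `ℓ z` are orthogonal, near `z₀`, to the wave front `foot + τ • dir` for a smooth
function `τ`. -/
def HasPotential (ℓ : Plane → OrientedLine) (z₀ : Plane) : Prop :=
  ∃ τ : Plane → ℝ, SmoothNear τ z₀ ∧
    ∀ᶠ z in 𝓝 z₀, ∀ v, fderiv ℝ τ z v = -⟪footDeriv ℓ z v, (ℓ z).dir⟫_ℝ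

/-! ### Derivatives of a ray family and the Lagrangian condition -/

section Kinematics

variable {ℓ : Plane → OrientedLine} {z₀ : Plane}

theorem SmoothRays.hasFDerivAt_dir (h : SmoothRays ℓ z₀) :
    HasFDerivAt (fun z => (ℓ z).dir) (dirDeriv ℓ z₀) z₀ :=
  h.dir.differentiableAt.hasFDerivAt

theorem SmoothRays.hasFDerivAt_foot (h : SmoothRays ℓ z₀) :
    HasFDerivAt (fun z => (ℓ z).foot) (footDeriv ℓ z₀) z₀ :=
  h.foot.differentiableAt.hasFDerivAt

theorem SmoothRays.inner_dirDeriv (h : SmoothRays ℓ z₀) (v : Plane) :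
    ⟪dirDeriv ℓ z₀ v, (ℓ z₀).dir⟫_ℝ = 0 := by
  have h1 := h.hasFDerivAt_dir.inner ℝ h.hasFDerivAt_dir
  have h2 : (fun z => ⟪(ℓ z).dir, (ℓ z).dir⟫_ℝ) = fun _ => (1 : ℝ) := by
    funext z; exact (ℓ z).inner_dir_self
  rw [h2] at h1
  have h3 := DFunLike.congr_fun (h1.unique (hasFDerivAt_const (1 : ℝ) z₀)) v
  simp [fderivInnerCLM_apply, real_inner_comm] at h3
  rw [real_inner_comm]; linarith

theorem SmoothRays.inner_footDeriv (h : SmoothRays ℓ z₀) (v : Plane) :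
    ⟪footDeriv ℓ z₀ v, (ℓ z₀).dir⟫_ℝ = -⟪(ℓ z₀).foot, dirDeriv ℓ z₀ v⟫_ℝ := by
  have h1 := h.hasFDerivAt_foot.inner ℝ h.hasFDerivAt_dir
  have h2 : (fun z => ⟪(ℓ z).foot, (ℓ z).dir⟫_ℝ) = fun _ => (0 : ℝ) := by
    funext z; exact (ℓ z).foot_orth
  rw [h2] at h1
  have h3 := DFunLike.congr_fun (h1.unique (hasFDerivAt_const (0 : ℝ) z₀)) v
  simp [fderivInnerCLM_apply] at h3
  linarith

/-- The velocity of a point which moves along with the rays. -/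
theorem SmoothRays.fderiv_point (h : SmoothRays ℓ z₀) {τ : Plane → ℝ}
    (hτ : DifferentiableAt ℝ τ z₀) {P : Plane → Space}
    (hP : P =ᶠ[𝓝 z₀] fun z => (ℓ z).foot + τ z • (ℓ z).dir) (v : Plane) :
    fderiv ℝ P z₀ v =
      footDeriv ℓ z₀ v + τ z₀ • dirDeriv ℓ z₀ v + fderiv ℝ τ z₀ v • (ℓ z₀).dir := by
  rw [hP.fderiv_eq]
  have : HasFDerivAt (fun z => (ℓ z).foot + τ z • (ℓ z).dir) _ z₀ :=
    h.hasFDerivAt_foot.add (hτ.hasFDerivAt.smul h.hasFDerivAt_dir)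
  rw [this.fderiv]
  simp [add_assoc]

/-- The point of parameter `p.2` on the ray `ℓ p.1`. -/
noncomputable def rayPoint (ℓ : Plane → OrientedLine) (p : Plane × ℝ) : Space :=
  (ℓ p.1).foot + p.2 • (ℓ p.1).dir

theorem SmoothRays.smoothNear_rayPoint (h : SmoothRays ℓ z₀) (t : ℝ) :
    SmoothNear (rayPoint ℓ) (z₀, t) := by
  have h1 : SmoothNear (Prod.fst : Plane × ℝ → Plane) (z₀, t) := smoothNear_of_contDiff contDiff_fst _
  have h2 : SmoothNear (Prod.snd : Plane × ℝ → ℝ) (z₀, t) := smoothNear_of_contDiff contDiff_snd _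
  exact (SmoothNear.comp (f := Prod.fst) h.foot h1).add
    (h2.smul (SmoothNear.comp (f := Prod.fst) h.dir h1))

theorem SmoothRays.fderiv_rayPoint (h : SmoothRays ℓ z₀) (t : ℝ) (v : Plane) (s : ℝ) :
    fderiv ℝ (rayPoint ℓ) (z₀, t) (v, s) =
      footDeriv ℓ z₀ v + t • dirDeriv ℓ z₀ v + s • (ℓ z₀).dir := by
  have h1 : HasFDerivAt (𝕜 := ℝ) (Prod.fst : Plane × ℝ → Plane) _ (z₀, t) := hasFDerivAt_fst
  have h2 : HasFDerivAt (𝕜 := ℝ) (Prod.snd : Plane × ℝ → ℝ) _ (z₀, t) := hasFDerivAt_snd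
  have h3 := (HasFDerivAt.comp (f := Prod.fst) (z₀, t) h.hasFDerivAt_foot h1).add
    (h2.smul (HasFDerivAt.comp (f := Prod.fst) (z₀, t) h.hasFDerivAt_dir h1))
  have h4 : HasFDerivAt (rayPoint ℓ) _ (z₀, t) := h3
  rw [h4.fderiv]
  simp [add_assoc]

/-- Near a non-focal point, the rays and the abscissa on them are coordinates of space. -/
theorem SmoothRays.exists_rayChart (h : SmoothRays ℓ z₀) {t₀ : ℝ} (hn : Nonfocal ℓ z₀ t₀) :
    ∃ Φ : OpenPartialHomeomorph (Plane × ℝ) Space, (z₀, t₀) ∈ Φ.source ∧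
      (∀ p, Φ p = rayPoint ℓ p) ∧ (∀ p ∈ Φ.source, ContDiffAt ℝ ∞ (rayPoint ℓ) p) ∧
      ∀ y ∈ Φ.target, ContDiffAt ℝ ∞ Φ.symm y := by
  have hinj : Function.Injective (fderiv ℝ (rayPoint ℓ) (z₀, t₀) : Plane × ℝ →ₗ[ℝ] Space) := by
    rw [injective_iff_map_eq_zero]
    rintro ⟨v, s⟩ hvs
    change fderiv ℝ (rayPoint ℓ) (z₀, t₀) (v, s) = 0 at hvs
    rw [h.fderiv_rayPoint] at hvs
    have hv := hn v s hvs
    subst hv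
    simpa [(ℓ z₀).dir_ne_zero] using hvs
  have hdim : Module.finrank ℝ (Plane × ℝ) = Module.finrank ℝ Space := by simp
  let e := (LinearMap.linearEquivOfInjective _ hinj hdim).toContinuousLinearEquiv
  refine exists_localDiffeo (h.smoothNear_rayPoint t₀) e ?_
  exact ContinuousLinearMap.ext fun p => rfl

/-- A family orthogonal to wave fronts is Lagrangian. -/
theorem SmoothRays.lagrangian (h : SmoothRays ℓ z₀) (hp : HasPotential ℓ z₀) (v w : Plane) :
    ⟪footDeriv ℓ z₀ v, dirDeriv ℓ z₀ w⟫_ℝ = ⟪footDeriv ℓ z₀ w, dirDeriv ℓ z₀ v⟫_ℝ := by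
  obtain ⟨τ, hτ, hd⟩ := hp
  have h2 : minSmoothness ℝ 2 ≤ (∞ : ℕ∞ω) := by
    rw [minSmoothness_of_isRCLikeNormedField]
    exact WithTop.coe_le_coe.2 (le_top : (2 : ℕ∞) ≤ ⊤)
  have key : ∀ (f : Plane → Space), SmoothNear f z₀ → IsSymmSndFDerivAt ℝ f z₀ := fun f hf =>
    hf.contDiffAt.isSymmSndFDerivAt h2
  have hsτ : IsSymmSndFDerivAt ℝ τ z₀ := hτ.contDiffAt.isSymmSndFDerivAt h2
  have hsf := key _ h.foot
  -- Differentiate `dτ v = -⟪dq v, u⟫` along `w`. The second derivatives of `τ` and `q` are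
  -- symmetric, so the remaining term is too.
  have hD : ∀ v w, fderiv ℝ (fderiv ℝ τ) z₀ w v =
      -(⟪fderiv ℝ (fderiv ℝ (fun z => (ℓ z).foot)) z₀ w v, (ℓ z₀).dir⟫_ℝ
        + ⟪footDeriv ℓ z₀ v, dirDeriv ℓ z₀ w⟫_ℝ) := by
    intro v w
    have h1 : HasFDerivAt (fun z => fderiv ℝ τ z v) _ z₀ :=
      hτ.fderiv.differentiableAt.hasFDerivAt.clm_apply (hasFDerivAt_const v z₀)
    have h2 : HasFDerivAt (fun z => footDeriv ℓ z v) _ z₀ :=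
      h.foot.fderiv.differentiableAt.hasFDerivAt.clm_apply (hasFDerivAt_const v z₀)
    have h3 := (h2.inner ℝ h.hasFDerivAt_dir).neg
    have h4 : (fun z => fderiv ℝ τ z v) =ᶠ[𝓝 z₀] fun z => -⟪footDeriv ℓ z v, (ℓ z).dir⟫_ℝ := by
      filter_upwards [hd] with z hz using hz v
    have h5 := DFunLike.congr_fun (h1.unique (h3.congr_of_eventuallyEq h4)) w
    simp [fderivInnerCLM_apply] at h5
    linarith
  have e1 := hD v w
  have e2 := hD w v
  rw [hsτ w v, e2, hsf w v] at e1
  linarith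

/-- Every ray of an immersed Lagrangian family carries a non-focal point. -/
theorem SmoothRays.exists_nonfocal (h : SmoothRays ℓ z₀) (hp : HasPotential ℓ z₀)
    (hi : ∀ v, dirDeriv ℓ z₀ v = 0 → footDeriv ℓ z₀ v = 0 → v = 0) : ∃ t, Nonfocal ℓ z₀ t := by
  by_contra! hcon
  -- If every point were focal, so would be those of abscissas 0, 1, 2, 3. As for eigenvectors of a
  -- symmetric operator, the vectors `du (v i)` would be pairwise orthogonal and non-zero: four of
  -- them in a space of dimension three.
  have hcon' : ∀ i : Fin 4, ∃ (v : Plane) (s : ℝ),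
      footDeriv ℓ z₀ v + ((i : ℕ) : ℝ) • dirDeriv ℓ z₀ v
      + s • (ℓ z₀).dir = 0 ∧ v ≠ 0 := by
    intro i
    have := hcon ((i : ℕ) : ℝ)
    simp only [Nonfocal] at this
    push Not at this
    exact this
  choose v s hvs hv using hcon'
  have hin : ∀ i w, ⟪footDeriv ℓ z₀ (v i), dirDeriv ℓ z₀ w⟫_ℝ
      = -(((i : ℕ) : ℝ) * ⟪dirDeriv ℓ z₀ (v i), dirDeriv ℓ z₀ w⟫_ℝ) := by
    intro i w
    have h1 := congrArg (fun x => ⟪x, dirDeriv ℓ z₀ w⟫_ℝ) (hvs i)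
    simp only [inner_add_left, real_inner_smul_left, inner_zero_left] at h1
    rw [real_inner_comm (dirDeriv ℓ z₀ w) (ℓ z₀).dir, h.inner_dirDeriv] at h1
    linarith
  have hli : LinearIndependent ℝ fun i => dirDeriv ℓ z₀ (v i) := by
    apply linearIndependent_of_ne_zero_of_inner_eq_zero
    · intro i h0
      refine hv i (hi _ h0 ?_)
      have h1 := hvs i
      rw [h0, smul_zero, add_zero] at h1
      have h2 := h.inner_footDeriv (v i)
      rw [h0, inner_zero_right, neg_zero, eq_neg_of_add_eq_zero_left h1, inner_neg_left,
        real_inner_smul_left, (ℓ z₀).inner_dir_self, mul_one, neg_eq_zero] at h2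
      rwa [h2, zero_smul, add_zero] at h1
    · intro i j hij
      have h1 := hin i (v j)
      have h2 := hin j (v i)
      rw [h.lagrangian hp, h2, real_inner_comm] at h1
      have h3 : (((i : ℕ) : ℝ) - ((j : ℕ) : ℝ)) *
          ⟪dirDeriv ℓ z₀ (v i), dirDeriv ℓ z₀ (v j)⟫_ℝ = 0 := by linarith
      refine (mul_eq_zero.1 h3).resolve_left fun h4 => hij (Fin.ext ?_)
      exact_mod_cast sub_eq_zero.1 h4
  have := hli.fintype_card_le_finrank
  simp at this

end Kinematics

/-! ### Sections and wave fronts near a non-focal point -/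

section LocalTheory

variable {ℓ : Plane → OrientedLine} {z₀ : Plane}

theorem rayPoint_mem_points (ℓ : Plane → OrientedLine) (z : Plane) (t : ℝ) :
    rayPoint ℓ (z, t) ∈ (ℓ z).points := ⟨t, rfl⟩

theorem inner_rayPoint (ℓ : Plane → OrientedLine) (p : Plane × ℝ) :
    ⟪rayPoint ℓ p, (ℓ p.1).dir⟫_ℝ = p.2 := (ℓ p.1).inner_point p.2

theorem eq_rayPoint {z : Plane} {y : Space} (hy : y ∈ (ℓ z).points) :
    y = rayPoint ℓ (z, ⟪y, (ℓ z).dir⟫_ℝ) := OrientedLine.eq_of_mem_points hy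

/-- The abscissa `⟪y, u z⟫` is continuous in `(z, y)`. Thus every point of `W` on a ray of `A` has
its coordinates in `N`, which excludes stray intersections far from `(z₀, t₀)`. -/
theorem SmoothRays.exists_box (h : SmoothRays ℓ z₀) {t₀ : ℝ} {N : Set (Plane × ℝ)}
    (hN : N ∈ 𝓝 (z₀, t₀)) :
    ∃ (A : Set Plane) (W : Set Space), IsOpen A ∧ z₀ ∈ A ∧ IsOpen W ∧ rayPoint ℓ (z₀, t₀) ∈ W ∧
      ∀ z ∈ A, ∀ y ∈ W, (z, ⟪y, (ℓ z).dir⟫_ℝ) ∈ N := by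
  have hc : ContinuousAt (fun q : Plane × Space => (q.1, ⟪q.2, (ℓ q.1).dir⟫_ℝ))
      (z₀, rayPoint ℓ (z₀, t₀)) := by
    have h1 : ContinuousAt (fun q : Plane × Space => (ℓ q.1).dir) (z₀, rayPoint ℓ (z₀, t₀)) :=
      ContinuousAt.comp (f := Prod.fst) (g := fun z => (ℓ z).dir) h.dir.continuousAt
        continuousAt_fst
    exact continuousAt_fst.prodMk (continuousAt_snd.inner h1)
  have hN' : N ∈ 𝓝 (z₀, ⟪rayPoint ℓ (z₀, t₀), (ℓ z₀).dir⟫_ℝ) := by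
    rwa [inner_rayPoint ℓ (z₀, t₀)]
  obtain ⟨A, W, hA, hz, hW, hx, hAW⟩ := mem_nhds_prod_iff'.1 (hc hN')
  exact ⟨A, W, hA, hz, hW, hx, fun z hz y hy => hAW (Set.mk_mem_prod hz hy)⟩

/-- A surface transverse to a ray at a non-focal point is a local section of the family. -/
theorem SmoothRays.exists_section (h : SmoothRays ℓ z₀) {t₀ : ℝ} (hn : Nonfocal ℓ z₀ t₀)
    {S : Set Space} (hS : IsSmoothSurface S) (hx : rayPoint ℓ (z₀, t₀) ∈ S)
    (ht : (ℓ z₀).dir ∉ tangentPlane S (rayPoint ℓ (z₀, t₀))) {O : Set Plane} (hO : O ∈ 𝓝 z₀) :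
    ∃ (e : Plane → Space) (G : Space → Plane) (A : Set Plane) (W : Set Space),
      IsOpen A ∧ IsOpen W ∧ z₀ ∈ A ∧ A ⊆ O ∧ e z₀ = rayPoint ℓ (z₀, t₀) ∧
      (∀ z ∈ A, ContDiffAt ℝ ∞ e z) ∧ (∀ y ∈ W, ContDiffAt ℝ ∞ G y) ∧
      (∀ z ∈ A, e z ∈ S ∩ W ∧ G (e z) = z) ∧ (∀ y ∈ S ∩ W, G y ∈ A ∧ e (G y) = y) ∧
      ∀ z ∈ A, (ℓ z).points ∩ (S ∩ W) = {e z} := by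
  obtain ⟨f, hf⟩ := hS _ hx
  obtain ⟨Φ, hΦ0, hΦ, hΦs, hΦi⟩ := h.exists_rayChart hn
  have hr := h.smoothNear_rayPoint t₀
  have hfs : SmoothNear (fun p => f (rayPoint ℓ p)) (z₀, t₀) := hf.smoothNear.comp hr
  have hfd : fderiv ℝ (fun p => f (rayPoint ℓ p)) (z₀, t₀) (0, 1) ≠ 0 := by
    have h1 : HasFDerivAt (fun p => f (rayPoint ℓ p)) _ (z₀, t₀) :=
      hf.smoothNear.differentiableAt.hasFDerivAt.comp (z₀, t₀) hr.differentiableAt.hasFDerivAt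
    rw [h1.fderiv, ContinuousLinearMap.comp_apply, h.fderiv_rayPoint]
    rw [hf.mem_tangentPlane_iff hx] at ht
    simpa using ht
  obtain ⟨τ, hτ, hτ0, hτiff⟩ :=
    exists_implicit hfs (hf.eventually_iff.self_of_nhds.1 hx) hfd
  have hN : ∀ᶠ p in 𝓝 (z₀, t₀), p ∈ Φ.source ∧ (rayPoint ℓ p ∈ S ↔ τ p.1 = p.2) := by
    filter_upwards [Φ.open_source.mem_nhds hΦ0, hr.continuousAt.eventually hf.eventually_iff, hτiff]
      with p h1 h2 h3 using ⟨h1, h2.trans h3⟩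
  obtain ⟨A₁, W₁, hA₁, hz₁, hW₁, hx₁, hbox⟩ := h.exists_box hN
  have hcτ : Filter.Tendsto (fun z => (z, τ z)) (𝓝 z₀) (𝓝 (z₀, t₀)) := by
    have := (continuousAt_id (x := z₀)).prodMk hτ.continuousAt
    simpa [ContinuousAt, hτ0] using this
  have hA : ∀ᶠ z in 𝓝 z₀, z ∈ O ∧ z ∈ A₁ ∧ ContDiffAt ℝ ∞ τ z ∧
      ((z, τ z) ∈ Φ.source ∧ (rayPoint ℓ (z, τ z) ∈ S ↔ τ z = τ z)) ∧
      rayPoint ℓ (z, τ z) ∈ W₁ := by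
    filter_upwards [hO, hA₁.mem_nhds hz₁, hτ, hcτ.eventually hN,
      hcτ.eventually (hr.continuousAt.eventually (hW₁.mem_nhds hx₁))] with z h1 h2 h3 h4 h5
      using ⟨h1, h2, h3, h4, h5⟩
  obtain ⟨A, hAP, hAo, hzA⟩ := eventually_nhds_iff.1 hA
  -- The first factor makes each point of `W` lie on a ray of `A`; `W₁` makes the intersection with
  -- `S` unique on each such ray.
  set W := (Φ.target ∩ Φ.symm ⁻¹' (Prod.fst ⁻¹' A)) ∩ W₁
  have hmemW : ∀ z ∈ A, rayPoint ℓ (z, τ z) ∈ W ∧ Φ.symm (rayPoint ℓ (z, τ z)) = (z, τ z) := by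
    intro z hz
    obtain ⟨-, -, -, ⟨hs, -⟩, hw⟩ := hAP z hz
    have h1 := Φ.left_inv hs
    have h2 := Φ.map_source hs
    rw [hΦ] at h1 h2
    refine ⟨⟨⟨h2, ?_⟩, hw⟩, h1⟩
    simp only [Set.mem_preimage, h1]
    exact hz
  have huniq : ∀ z ∈ A, ∀ y ∈ (ℓ z).points ∩ (S ∩ W), y = rayPoint ℓ (z, τ z) := by
    rintro z hz y ⟨hy, hyS, hyW⟩
    have h1 := hbox z (hAP z hz).2.1 y hyW.2
    have h2 := eq_rayPoint hy
    rw [h2] at hyS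
    have h3 : τ z = ⟪y, (ℓ z).dir⟫_ℝ := h1.2.1 hyS
    rwa [← h3] at h2
  refine ⟨fun z => rayPoint ℓ (z, τ z), fun y => (Φ.symm y).1, A, W, hAo, ?_, hzA,
    fun z hz => (hAP z hz).1, by simp [hτ0], ?_, ?_, ?_, ?_, ?_⟩
  · exact (Φ.symm.isOpen_inter_preimage (hAo.preimage continuous_fst)).inter hW₁
  · intro z hz
    obtain ⟨-, -, hs, ⟨hs', -⟩, -⟩ := hAP z hz
    exact ContDiffAt.comp (f := fun z => (z, τ z)) z (hΦs _ hs') (contDiffAt_id.prodMk hs)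
  · intro y hy
    exact (hΦi y hy.1.1).fst
  · intro z hz
    exact ⟨⟨(hAP z hz).2.2.2.1.2.2 rfl, (hmemW z hz).1⟩, congrArg Prod.fst (hmemW z hz).2⟩
  · rintro y ⟨hyS, hyW⟩
    refine ⟨hyW.1.2, (huniq _ hyW.1.2 y ⟨?_, hyS, hyW⟩).symm⟩
    have h1 := Φ.right_inv hyW.1.1
    rw [hΦ] at h1
    have h2 := rayPoint_mem_points ℓ (Φ.symm y).1 (Φ.symm y).2
    rwa [h1] at h2
  · intro z hz
    refine Set.Subset.antisymm (fun y hy => huniq z hz y hy) ?_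
    rintro _ rfl
    exact ⟨rayPoint_mem_points _ _ _, (hAP z hz).2.2.2.1.2.2 rfl, (hmemW z hz).1⟩

/-- The velocity of a moving point of a surface is tangent to the surface. -/
theorem fderiv_mem_tangentPlane {S : Set Space} {e : Plane → Space} {z : Plane}
    (he : DifferentiableAt ℝ e z) (hS : ∀ᶠ y in 𝓝 z, e y ∈ S) (v : Plane) :
    fderiv ℝ e z v ∈ tangentPlane S (e z) := by
  have hl : HasDerivAt (fun t : ℝ => z + t • v) v 0 := by
    simpa using ((hasDerivAt_id (0 : ℝ)).smul_const v).const_add z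
  have he' : HasFDerivAt e (fderiv ℝ e z) (z + (0 : ℝ) • v) := by simpa using he.hasFDerivAt
  refine ⟨fun t : ℝ => e (z + t • v), by simp, ?_, he'.comp_hasDerivAt (0 : ℝ) hl⟩
  have hc : Filter.Tendsto (fun t : ℝ => z + t • v) (𝓝 0) (𝓝 z) := by
    simpa [ContinuousAt] using hl.continuousAt
  exact hc.eventually hS

/-- A family which orthogonally crosses a surface, in a smoothly moving point, has a potential. -/
theorem SmoothRays.hasPotential_of_crossesOrthogonally (h : SmoothRays ℓ z₀) {S : Set Space}
    {e : Plane → Space} (he : SmoothNear e z₀) (hm : ∀ᶠ z in 𝓝 z₀, e z ∈ (ℓ z).points ∩ S)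
    (hS : ∀ᶠ z in 𝓝 z₀, CrossesOrthogonally (ℓ z) S) : HasPotential ℓ z₀ := by
  have hτ := he.inner h.dir
  -- The potential is the abscissa of the crossing point: orthogonality reads `0 = ⟪u, de⟫ = ⟪u, dq⟫
  -- + dτ`.
  refine ⟨fun z => ⟪e z, (ℓ z).dir⟫_ℝ, hτ, ?_⟩
  filter_upwards [h.eventually, he.eventually_nhds, hm.eventually_nhds, hS, hτ.eventually_nhds]
    with z hz hez hmz hSz hτz v
  have hez : SmoothNear e z := hez
  have hτz : SmoothNear (fun z => ⟪e z, (ℓ z).dir⟫_ℝ) z := hτz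
  have h1 := hz.fderiv_point hτz.differentiableAt (P := e)
    (by filter_upwards [hmz] with y hy using OrientedLine.eq_of_mem_points hy.1) v
  have h2 := hSz.2 _ hmz.self_of_nhds _ (fderiv_mem_tangentPlane hez.differentiableAt
    (by filter_upwards [hmz] with y hy using hy.2) v)
  rw [h1, inner_add_right, inner_add_right, real_inner_smul_right, real_inner_smul_right,
    (ℓ z).inner_dir_self, real_inner_comm, real_inner_comm (dirDeriv ℓ z v),
    hz.inner_dirDeriv] at h2
  linarith

/-- If the rays of the family are a local chart of a plane which they cross orthogonally at a point,
this point is not focal. -/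
theorem SmoothRays.nonfocal_of_section (h : SmoothRays ℓ z₀) {e : Plane → Space}
    (he : SmoothNear e z₀) (hm : ∀ᶠ z in 𝓝 z₀, e z ∈ (ℓ z).points)
    (hp : ∀ᶠ z in 𝓝 z₀, ⟪e z - e z₀, (ℓ z₀).dir⟫_ℝ = 0)
    (hi : ∀ v, fderiv ℝ e z₀ v = 0 → v = 0) : Nonfocal ℓ z₀ ⟪e z₀, (ℓ z₀).dir⟫_ℝ := by
  intro v s hv
  apply hi
  have h1 := h.fderiv_point (he.inner h.dir).differentiableAt (P := e)
    (by filter_upwards [hm] with y hy using OrientedLine.eq_of_mem_points hy) v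
  rw [eq_neg_of_add_eq_zero_left hv, ← neg_smul, ← add_smul] at h1
  have h2 : HasFDerivAt (fun z => ⟪e z - e z₀, (ℓ z₀).dir⟫_ℝ) _ z₀ :=
    (he.differentiableAt.hasFDerivAt.sub_const (e z₀)).inner ℝ
      (hasFDerivAt_const (ℓ z₀).dir z₀)
  have h3 := DFunLike.congr_fun
    (h2.unique ((hasFDerivAt_const (0 : ℝ) z₀).congr_of_eventuallyEq hp)) v
  simp [fderivInnerCLM_apply] at h3
  rw [h1, real_inner_smul_left, (ℓ z₀).inner_dir_self, mul_one] at h3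
  rw [h1, h3, zero_smul]

/-- A family with a potential is orthogonal to a surface through any of its non-focal points. -/
theorem SmoothRays.exists_wavefront (h : SmoothRays ℓ z₀) {t₀ : ℝ} (hn : Nonfocal ℓ z₀ t₀)
    (hp : HasPotential ℓ z₀) :
    ∃ S : Set Space, IsSmoothSurface S ∧ rayPoint ℓ (z₀, t₀) ∈ S ∧
      ∀ᶠ z in 𝓝 z₀, CrossesOrthogonally (ℓ z) S := by
  -- A potential is free up to a constant, adjusted here so that the front passes through the given
  -- point.
  obtain ⟨τ, hτ, hτ0, hτd⟩ : ∃ τ : Plane → ℝ, SmoothNear τ z₀ ∧ τ z₀ = t₀ ∧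
      ∀ᶠ z in 𝓝 z₀, ∀ v, fderiv ℝ τ z v = -⟪footDeriv ℓ z v, (ℓ z).dir⟫_ℝ := by
    obtain ⟨σ, hσ, hσd⟩ := hp
    refine ⟨fun z => σ z + (t₀ - σ z₀), hσ.add (smoothNear_const _ _), by simp, ?_⟩
    filter_upwards [hσd] with z hz v
    rw [fderiv_add_const, hz]
  obtain ⟨Φ, hΦ0, hΦ, hΦs, hΦi⟩ := h.exists_rayChart hn
  obtain ⟨A₁, W₁, hA₁, hz₁, hW₁, hx₁, hbox⟩ := h.exists_box (Φ.open_source.mem_nhds hΦ0)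
  have hcτ : Filter.Tendsto (fun z => (z, τ z)) (𝓝 z₀) (𝓝 (z₀, t₀)) := by
    have := (continuousAt_id (x := z₀)).prodMk hτ.continuousAt
    simpa [ContinuousAt, hτ0] using this
  have hr := h.smoothNear_rayPoint t₀
  have hA : ∀ᶠ z in 𝓝 z₀, z ∈ A₁ ∧ ContDiffAt ℝ ∞ τ z ∧ (z, τ z) ∈ Φ.source ∧
      rayPoint ℓ (z, τ z) ∈ W₁ ∧ SmoothRays ℓ z ∧
      ∀ v, fderiv ℝ τ z v = -⟪footDeriv ℓ z v, (ℓ z).dir⟫_ℝ := by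
    filter_upwards [hA₁.mem_nhds hz₁, hτ, hcτ.eventually (Φ.open_source.mem_nhds hΦ0),
      hcτ.eventually (hr.continuousAt.eventually (hW₁.mem_nhds hx₁)), h.eventually, hτd]
      with z h1 h2 h3 h4 h5 h6 using ⟨h1, h2, h3, h4, h5, h6⟩
  obtain ⟨A, hAP, hAo, hzA⟩ := eventually_nhds_iff.1 hA
  set W := (Φ.target ∩ Φ.symm ⁻¹' (Prod.fst ⁻¹' A)) ∩ W₁
  have hWo : IsOpen W :=
    (Φ.symm.isOpen_inter_preimage (hAo.preimage continuous_fst)).inter hW₁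
  -- In ray coordinates `(z, t)` the front is the graph `t = τ z`; its equation has derivative 1
  -- along the ray, hence is regular.
  set f : Space → ℝ := fun y => (Φ.symm y).2 - τ (Φ.symm y).1 with hf
  set S : Set Space := {y | y ∈ W ∧ f y = 0} with hS
  have hfs : ContDiffOn ℝ ∞ f W := fun y hy =>
    ((hΦi y hy.1.1).snd.sub ((hAP _ hy.1.2).2.1.comp y (hΦi y hy.1.1).fst)).contDiffWithinAt
  have hfd : ∀ y ∈ W, ∀ v, fderiv ℝ f y v =
      (fderiv ℝ Φ.symm y v).2 - fderiv ℝ τ (Φ.symm y).1 (fderiv ℝ Φ.symm y v).1 := by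
    intro y hy v
    have h1 := ((hΦi y hy.1.1).differentiableAt (by simp)).hasFDerivAt
    have h2 := ((hAP _ hy.1.2).2.1.differentiableAt (by simp)).hasFDerivAt
    have h3 : HasFDerivAt f _ y := h1.snd.sub (h2.comp y h1.fst)
    rw [h3.fderiv]
    simp
  have hTR : ∀ y ∈ W, ∀ p, fderiv ℝ Φ.symm y (fderiv ℝ (rayPoint ℓ) (Φ.symm y) p) = p := by
    intro y hy p
    have hps := Φ.map_target hy.1.1
    have h1 := ((hΦs _ hps).differentiableAt (by simp)).hasFDerivAt
    have e1 : rayPoint ℓ (Φ.symm y) = y := by rw [← hΦ, Φ.right_inv hy.1.1]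
    have h2 : HasFDerivAt Φ.symm (fderiv ℝ Φ.symm y) (rayPoint ℓ (Φ.symm y)) := by
      rw [e1]; exact ((hΦi y hy.1.1).differentiableAt (by simp)).hasFDerivAt
    have h3 := h2.comp _ h1
    have h4 : (Φ.symm ∘ rayPoint ℓ) =ᶠ[𝓝 (Φ.symm y)] id := by
      filter_upwards [Φ.open_source.mem_nhds hps] with q hq
      simp only [Function.comp, ← hΦ, Φ.left_inv hq, id]
    exact DFunLike.congr_fun (h3.unique ((hasFDerivAt_id _).congr_of_eventuallyEq h4)) p
  have hRT : ∀ y ∈ W, ∀ v, fderiv ℝ (rayPoint ℓ) (Φ.symm y) (fderiv ℝ Φ.symm y v) = v := by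
    intro y hy v
    have hps := Φ.map_target hy.1.1
    have h1 := ((hΦs _ hps).differentiableAt (by simp)).hasFDerivAt
    have h3 := h1.comp y ((hΦi y hy.1.1).differentiableAt (by simp)).hasFDerivAt
    have h4 : (rayPoint ℓ ∘ Φ.symm) =ᶠ[𝓝 y] id := by
      filter_upwards [Φ.open_target.mem_nhds hy.1.1] with q hq
      simp only [Function.comp, ← hΦ, Φ.right_inv hq, id]
    exact DFunLike.congr_fun (h3.unique ((hasFDerivAt_id _).congr_of_eventuallyEq h4)) v
  have hRf : ∀ y ∈ W, ∀ p : Plane × ℝ, fderiv ℝ (rayPoint ℓ) (Φ.symm y) p =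
      footDeriv ℓ (Φ.symm y).1 p.1 + (Φ.symm y).2 • dirDeriv ℓ (Φ.symm y).1 p.1
        + p.2 • (ℓ (Φ.symm y).1).dir := fun y hy p =>
    (hAP _ hy.1.2).2.2.2.2.1.fderiv_rayPoint (Φ.symm y).2 p.1 p.2
  have hloc : ∀ y ∈ W, IsLocalEquation S y f := by
    intro y hy
    refine ⟨W, hWo, hy, hfs, ?_, fun x hx => ⟨fun h => h.2, fun h => ⟨hx, h⟩⟩⟩
    intro h0
    have h1 := hfd y hy (fderiv ℝ (rayPoint ℓ) (Φ.symm y) (0, 1))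
    rw [hTR y hy, h0] at h1
    simp at h1
  have hmem : ∀ z ∈ A, rayPoint ℓ (z, τ z) ∈ S := by
    intro z hz
    obtain ⟨-, -, hs, hw, -⟩ := hAP z hz
    have h1 := Φ.left_inv hs
    have h2 := Φ.map_source hs
    rw [hΦ] at h1 h2
    refine ⟨⟨⟨h2, ?_⟩, hw⟩, ?_⟩
    · simp only [Set.mem_preimage, h1]
      exact hz
    · simp [hf, h1]
  refine ⟨S, fun y hy => ⟨f, hloc y hy.1⟩, hτ0 ▸ hmem z₀ hzA, ?_⟩
  filter_upwards [hAo.mem_nhds hzA] with z hz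
  refine ⟨⟨_, rayPoint_mem_points _ _ _, hmem z hz⟩, ?_⟩
  rintro y ⟨hy, hyS⟩ v hv
  rw [(hloc y hyS.1).mem_tangentPlane_iff hyS, hfd y hyS.1] at hv
  -- Orthogonality is required at every crossing, not only at the expected one. The box forces `y`
  -- to have ray coordinate `z`; a tangent vector with coordinates `(a, b)` then has `b = dτ a`, and
  -- its product with `u` is `⟪dq a, u⟫ + b = 0`.
  have hm := hbox z (hAP z hz).1 y hyS.1.2
  have hsymm : (Φ.symm y).1 = z := by
    have h1 := Φ.left_inv hm
    rw [hΦ, ← eq_rayPoint hy] at h1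
    rw [h1]
  have h5 := hRT y hyS.1 v
  rw [hRf y hyS.1] at h5
  rw [← h5]
  rw [hsymm] at hv ⊢
  obtain ⟨-, -, -, -, hz', hpot⟩ := hAP z hz
  rw [hpot] at hv
  rw [inner_add_right, inner_add_right, real_inner_smul_right, real_inner_smul_right,
    (ℓ z).inner_dir_self, real_inner_comm, real_inner_comm (dirDeriv ℓ z _),
    hz'.inner_dirDeriv]
  linarith

end LocalTheory

/-! ### The action of one surface -/

/-- The common form of the laws of reflection (`κ = -1`) and of refraction (`κ = 1`). -/
def DeviationLaw (κ n₁ n₂ : ℝ) (ν u₁ u₂ : Space) : Prop :=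
  0 < κ * (⟪u₁, ν⟫_ℝ * ⟪u₂, ν⟫_ℝ) ∧ ∃ c : ℝ, n₂ • u₂ - n₁ • u₁ = c • ν

theorem ReflectionLaw.deviationLaw {ν u₁ u₂ : Space} (hν : ‖ν‖ = 1) (h : ReflectionLaw ν u₁ u₂)
    (n : ℝ) : DeviationLaw (-1) n n ν u₁ u₂ := by
  obtain ⟨h0, rfl⟩ := h
  refine ⟨?_, -(n * (2 * ⟪u₁, ν⟫_ℝ)), by module⟩
  rw [inner_sub_left, real_inner_smul_left, real_inner_self_eq_norm_sq, hν]
  have := mul_self_pos.2 h0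
  nlinarith

theorem RefractionLaw.deviationLaw {ν u₁ u₂ : Space} {n₁ n₂ : ℝ} (h : RefractionLaw n₁ n₂ ν u₁ u₂) :
    DeviationLaw 1 n₁ n₂ ν u₁ u₂ := by
  refine ⟨by simpa using h.1, n₂ * ⟪u₂, ν⟫_ℝ - n₁ * ⟪u₁, ν⟫_ℝ, ?_⟩
  have := h.2
  rw [smul_sub, smul_sub, sub_eq_sub_iff_add_eq_add] at this
  rw [sub_smul, mul_smul, mul_smul, sub_eq_sub_iff_add_eq_add, this, add_comm]

/-- The sign `κ` depends on the surface alone, not on the ray, so one branch of the solution serves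
all neighbouring rays. -/
theorem OpticalSystem.exists_deviationLaw {N : ℕ} (sys : OpticalSystem N) (i : Fin N) :
    ∃ κ : ℝ, (κ = 1 ∨ κ = -1) ∧ ∀ ν u₁ u₂ : Space, ‖ν‖ = 1 → sys.Law i ν u₁ u₂ →
      DeviationLaw κ (sys.index i.castSucc) (sys.index i.succ) ν u₁ u₂ := by
  rcases hk : sys.kind i with _ | _
  · refine ⟨-1, Or.inr rfl, fun ν u₁ u₂ hν h => ?_⟩
    rw [OpticalSystem.Law, hk] at h
    rw [sys.index_reflecting i hk]
    exact h.deviationLaw hν _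
  · refine ⟨1, Or.inl rfl, fun ν u₁ u₂ _ h => ?_⟩
    rw [OpticalSystem.Law, hk] at h
    exact h.deviationLaw

/-- The normal enters the inequality twice, so `c` contributes only the positive factor `c²`. -/
theorem DeviationLaw.of_smul {κ n₁ n₂ c : ℝ} {g u₁ u₂ : Space} (hc : c ≠ 0)
    (h : DeviationLaw κ n₁ n₂ (c • g) u₁ u₂) : DeviationLaw κ n₁ n₂ g u₁ u₂ := by
  obtain ⟨h1, d, h2⟩ := h
  refine ⟨?_, d * c, by rw [h2, mul_smul]⟩
  rw [real_inner_smul_right, real_inner_smul_right] at h1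
  have : κ * (c * ⟪u₁, g⟫_ℝ * (c * ⟪u₂, g⟫_ℝ)) = (c * c) * (κ * (⟪u₁, g⟫_ℝ * ⟪u₂, g⟫_ℝ)) := by ring
  rw [this] at h1
  exact (pos_iff_pos_of_mul_pos h1).1 (mul_self_pos.2 hc)

theorem DeviationLaw.inner_ne_zero {κ n₁ n₂ : ℝ} {g u₁ u₂ : Space}
    (h : DeviationLaw κ n₁ n₂ g u₁ u₂) : ⟪u₁, g⟫_ℝ ≠ 0 ∧ ⟪u₂, g⟫_ℝ ≠ 0 := by
  constructor <;> intro h0 <;> simpa [h0] using h.1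

/-- The square of `n₂ * ⟪u₂, g⟫`, computed from the incoming ray. -/
noncomputable def deviationDiscr (n₁ n₂ : ℝ) (g u₁ : Space) : ℝ :=
  (n₁ * ⟪u₁, g⟫_ℝ) ^ 2 + ⟪g, g⟫_ℝ * (n₂ ^ 2 - n₁ ^ 2)

/-- The multiplier `c` in `n₂ u₂ = n₁ u₁ + c g`, computed from the incoming ray; the sign `η` is
the sign of `⟪u₂, g⟫`. -/
noncomputable def deviationCoeff (η n₁ n₂ : ℝ) (g u₁ : Space) : ℝ :=
  (η * √(deviationDiscr n₁ n₂ g u₁) - n₁ * ⟪u₁, g⟫_ℝ) * (⟪g, g⟫_ℝ)⁻¹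

/-- Taking norms in `n₂ u₂ = n₁ u₁ + c g` gives a quadratic equation for `c`. Its reduced
discriminant is `(n₂ ⟪u₂, g⟫)²`, non-zero by transversality, and `η` selects the root. -/
theorem DeviationLaw.solve {κ n₁ n₂ η : ℝ} {g u₁ u₂ : Space} (h : DeviationLaw κ n₁ n₂ g u₁ u₂)
    (hg : g ≠ 0) (hn₂ : 0 < n₂) (hu₁ : ⟪u₁, u₁⟫_ℝ = 1) (hu₂ : ⟪u₂, u₂⟫_ℝ = 1)
    (hη : η = 1 ∨ η = -1) (hη2 : 0 < η * ⟪u₂, g⟫_ℝ) :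
    deviationDiscr n₁ n₂ g u₁ ≠ 0 ∧ n₂ • u₂ = n₁ • u₁ + deviationCoeff η n₁ n₂ g u₁ • g := by
  obtain ⟨-, c, hc⟩ := h
  have hG : ⟪g, g⟫_ℝ ≠ 0 := inner_self_ne_zero.2 hg
  have hc' : n₂ • u₂ = n₁ • u₁ + c • g := by rw [← hc]; abel
  have h1 := congrArg (fun x => ⟪x, g⟫_ℝ) hc'
  simp only [inner_add_left, real_inner_smul_left] at h1
  have h2 := congrArg (fun x => ⟪x, x⟫_ℝ) hc'
  simp only [inner_add_left, inner_add_right, real_inner_smul_left, real_inner_smul_right,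
    hu₁, hu₂, real_inner_comm u₁ g] at h2
  have hη' : η * η = 1 := by rcases hη with rfl | rfl <;> norm_num
  have h3 : deviationDiscr n₁ n₂ g u₁ = (η * (n₂ * ⟪u₂, g⟫_ℝ)) ^ 2 := by
    rw [mul_pow, pow_two η, hη', h1, deviationDiscr]
    linear_combination ⟪g, g⟫_ℝ * h2
  have h4 : 0 < η * (n₂ * ⟪u₂, g⟫_ℝ) := by
    have := mul_pos hn₂ hη2
    linarith
  refine ⟨by rw [h3]; positivity, ?_⟩
  rw [hc', deviationCoeff, h3, Real.sqrt_sq h4.le, ← mul_assoc η, hη', one_mul, h1]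
  congr 2
  field_simp
  ring

/-! ### Smoothness, immersivity and potential across one surface -/

section Step

variable {ℓ ℓ' : Plane → OrientedLine} {z₀ : Plane} {P : Plane → Space} {S : Set Space}

/-- The point where a smooth family of rays meets a surface transversally moves smoothly, if it
moves continuously. -/
theorem SmoothRays.smoothNear_hit (h : SmoothRays ℓ z₀) {f : Space → ℝ}
    (hf : IsLocalEquation S (P z₀) f) (hPS : ∀ z, P z ∈ S) (hPc : ContinuousAt P z₀)
    (hP : ∀ z, P z ∈ (ℓ z).points) (ht : ⟪(ℓ z₀).dir, gradient f (P z₀)⟫_ℝ ≠ 0) :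
    SmoothNear P z₀ := by
  set t₀ := ⟪P z₀, (ℓ z₀).dir⟫_ℝ
  have hP0 : rayPoint ℓ (z₀, t₀) = P z₀ := (eq_rayPoint (hP z₀)).symm
  have hr := h.smoothNear_rayPoint t₀
  have hf' : SmoothNear f (rayPoint ℓ (z₀, t₀)) := hP0 ▸ hf.smoothNear
  have hfd : fderiv ℝ (fun p => f (rayPoint ℓ p)) (z₀, t₀) (0, 1) ≠ 0 := by
    have h1 : HasFDerivAt (fun p => f (rayPoint ℓ p)) _ (z₀, t₀) :=
      hf'.differentiableAt.hasFDerivAt.comp (z₀, t₀) hr.differentiableAt.hasFDerivAt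
    rw [h1.fderiv, ContinuousLinearMap.comp_apply, h.fderiv_rayPoint, hP0,
      fderiv_eq_inner_gradient, real_inner_comm]
    simpa using ht
  obtain ⟨τ, hτ, hτ0, hτiff⟩ := exists_implicit (hf'.comp hr)
    (by simpa [hP0] using hf.eventually_iff.self_of_nhds.1 (hPS z₀)) hfd
  -- A ray may meet the surface several times; continuity of `P` keeps the hit on the branch given
  -- by the implicit function.
  have hc : Filter.Tendsto (fun z => (z, ⟪P z, (ℓ z).dir⟫_ℝ)) (𝓝 z₀) (𝓝 (z₀, t₀)) :=
    (continuousAt_id (x := z₀)).prodMk (hPc.inner h.dir.continuousAt)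
  refine (h.foot.add (hτ.smul h.dir)).congr ?_
  filter_upwards [hc.eventually hτiff, hPc.eventually hf.eventually_iff] with z h1 h2
  have h3 : τ z = ⟪P z, (ℓ z).dir⟫_ℝ := by
    refine h1.1 ?_
    rw [← eq_rayPoint (hP z)]
    exact h2.1 (hPS z)
  rw [h3]
  exact eq_rayPoint (hP z)

theorem foot_eq {L : OrientedLine} {p : Space} (hp : p ∈ L.points) :
    L.foot = p - ⟪p, L.dir⟫_ℝ • L.dir :=
  congrArg OrientedLine.foot (L.eq_through p hp)

/-- Reflection or refraction by a surface preserves the smooth immersed families of rays which are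
orthogonal to wave fronts. -/
theorem SmoothRays.deviate (h : SmoothRays ℓ z₀)
    (hi : ∀ v, dirDeriv ℓ z₀ v = 0 → footDeriv ℓ z₀ v = 0 → v = 0) (hp : HasPotential ℓ z₀)
    {κ n₁ n₂ : ℝ} (hκ : κ = 1 ∨ κ = -1) (hn₁ : 0 < n₁) (hn₂ : 0 < n₂) (hS : IsSmoothSurface S)
    (hPS : ∀ z, P z ∈ S) (hPc : ContinuousAt P z₀) (hP : ∀ z, P z ∈ (ℓ z).points)
    (hP' : ∀ z, P z ∈ (ℓ' z).points)
    (hlaw : ∀ z, ∃ ν, IsUnitNormal S (P z) ν ∧ DeviationLaw κ n₁ n₂ ν (ℓ z).dir (ℓ' z).dir) :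
    SmoothRays ℓ' z₀ ∧ (∀ v, dirDeriv ℓ' z₀ v = 0 → footDeriv ℓ' z₀ v = 0 → v = 0) ∧
      HasPotential ℓ' z₀ := by
  obtain ⟨f, hf⟩ := hS _ (hPS z₀)
  have hlaw' : ∀ z, IsLocalEquation S (P z) f →
      DeviationLaw κ n₁ n₂ (gradient f (P z)) (ℓ z).dir (ℓ' z).dir := by
    intro z hz
    obtain ⟨ν, hν, hl⟩ := hlaw z
    obtain ⟨c, hc, rfl⟩ := hz.unitNormal_eq (hPS z) hν
    exact hl.of_smul hc
  have hl0 := hlaw' z₀ hf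
  have hPs : SmoothNear P z₀ := h.smoothNear_hit hf hPS hPc hP hl0.inner_ne_zero.1
  set g : Plane → Space := fun z => gradient f (P z) with hg
  have hgs : SmoothNear g z₀ := hf.smoothNear.gradient.comp hPs
  have hfz : ∀ᶠ z in 𝓝 z₀, IsLocalEquation S (P z) f := hPc.eventually hf.eventually
  have hu : SmoothNear (fun z => ⟪(ℓ z).dir, g z⟫_ℝ) z₀ := h.dir.inner hgs
  -- By the law, the sign of `⟪u', g⟫` is that of `κ ⟪u, g⟫`. The latter involves only incoming
  -- data, so it is locally constant before anything is known of the continuity of `u'`.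
  obtain ⟨η, hη, hη0⟩ : ∃ η : ℝ, (η = 1 ∨ η = -1) ∧ 0 < η * (κ * ⟪(ℓ z₀).dir, g z₀⟫_ℝ) := by
    have h0 : κ * ⟪(ℓ z₀).dir, g z₀⟫_ℝ ≠ 0 := by
      refine mul_ne_zero ?_ hl0.inner_ne_zero.1
      rcases hκ with rfl | rfl <;> norm_num
    rcases h0.lt_or_gt with h0 | h0
    · exact ⟨-1, Or.inr rfl, by linarith⟩
    · exact ⟨1, Or.inl rfl, by linarith⟩
  have hηz : ∀ᶠ z in 𝓝 z₀, 0 < η * (κ * ⟪(ℓ z).dir, g z⟫_ℝ) :=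
    ((continuousAt_const.mul (continuousAt_const.mul hu.continuousAt))).eventually
      (lt_mem_nhds hη0)
  set lam : Plane → ℝ := fun z => deviationCoeff η n₁ n₂ (g z) (ℓ z).dir
  have hsolve : ∀ᶠ z in 𝓝 z₀, deviationDiscr n₁ n₂ (g z) (ℓ z).dir ≠ 0 ∧
      n₂ • (ℓ' z).dir = n₁ • (ℓ z).dir + lam z • g z := by
    filter_upwards [hfz, hηz] with z h1 h2
    have h3 := hlaw' z h1
    refine h3.solve h1.gradient_ne_zero hn₂ (ℓ z).inner_dir_self (ℓ' z).inner_dir_self hη ?_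
    have h4 := mul_pos h2 h3.1
    have h5 : η * (κ * ⟪(ℓ z).dir, g z⟫_ℝ) *
        (κ * (⟪(ℓ z).dir, gradient f (P z)⟫_ℝ * ⟪(ℓ' z).dir, gradient f (P z)⟫_ℝ)) =
        (κ * ⟪(ℓ z).dir, g z⟫_ℝ) ^ 2 * (η * ⟪(ℓ' z).dir, gradient f (P z)⟫_ℝ) := by
      simp only [hg]; ring
    rw [h5] at h4
    exact pos_of_mul_pos_right h4 (sq_nonneg _)
  have hG : ∀ᶠ z in 𝓝 z₀, g z ≠ 0 := by
    filter_upwards [hfz] with z hz using hz.gradient_ne_zero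
  have hlams : SmoothNear lam z₀ := by
    have hgg := hgs.inner hgs
    have hdis : SmoothNear (fun z => deviationDiscr n₁ n₂ (g z) (ℓ z).dir) z₀ := by
      have h1 := (smoothNear_const n₁ z₀).mul hu
      have h2 := (h1.mul h1).add (hgg.mul (smoothNear_const (n₂ ^ 2 - n₁ ^ 2) z₀))
      simpa only [deviationDiscr, pow_two (n₁ * _)] using h2
    exact (((smoothNear_const η z₀).mul (hdis.sqrt hsolve.self_of_nhds.1)).sub
      ((smoothNear_const n₁ z₀).mul hu)).mul
        (hgg.inv (inner_self_ne_zero.2 hG.self_of_nhds))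
  have hdir' : SmoothNear (fun z => (ℓ' z).dir) z₀ := by
    refine ((smoothNear_const n₂⁻¹ z₀).smul
      (((smoothNear_const n₁ z₀).smul h.dir).add (hlams.smul hgs))).congr ?_
    filter_upwards [hsolve] with z hz
    rw [← hz.2, inv_smul_smul₀ hn₂.ne']
  have hfoot' : SmoothNear (fun z => (ℓ' z).foot) z₀ :=
    (hPs.sub ((hPs.inner hdir').smul hdir')).congr
      (Filter.Eventually.of_forall fun z => foot_eq (hP' z))
  have h' : SmoothRays ℓ' z₀ := ⟨hdir', hfoot'⟩
  have htan : ∀ᶠ z in 𝓝 z₀, ∀ v, ⟪g z, fderiv ℝ P z v⟫_ℝ = 0 := by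
    filter_upwards [hfz, hPs.eventually_nhds] with z h1 h2 v
    have h3 := fderiv_mem_tangentPlane (SmoothNear.differentiableAt h2)
      (Filter.Eventually.of_forall hPS) v
    rwa [h1.mem_tangentPlane_iff (hPS z), fderiv_eq_inner_gradient] at h3
  have hs := hPs.inner h.dir
  have hs' := hPs.inner h'.dir
  refine ⟨h', ?_, ?_⟩
  -- If `du' v` and `dq' v` vanish, `dP v` is a multiple of `u'` tangent to `S`, hence zero by
  -- transversality. Then `dg v = 0` and `n₁ du v` is a multiple of `g`; since `du v` is orthogonal
  -- to `u` and `g` is not, `du v = 0`. So `dq v` is a multiple of `u`, and it is orthogonal to `u`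
  -- because `du v = 0`.
  · intro v hv1 hv2
    have hDP' := h'.fderiv_point hs'.differentiableAt (P := P)
      (Filter.Eventually.of_forall fun z => OrientedLine.eq_of_mem_points (hP' z)) v
    have hDP := h.fderiv_point hs.differentiableAt (P := P)
      (Filter.Eventually.of_forall fun z => OrientedLine.eq_of_mem_points (hP z)) v
    rw [hv1, hv2, smul_zero, add_zero, zero_add] at hDP'
    have ht0 := htan.self_of_nhds v
    rw [hDP', real_inner_smul_right, real_inner_comm] at ht0
    have hDs' := (mul_eq_zero.1 ht0).resolve_right hl0.inner_ne_zero.2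
    rw [hDs', zero_smul] at hDP'
    have hDg : fderiv ℝ g z₀ v = 0 := by
      have h1 : HasFDerivAt g _ z₀ :=
        hf.smoothNear.gradient.differentiableAt.hasFDerivAt.comp z₀ hPs.differentiableAt.hasFDerivAt
      rw [h1.fderiv, ContinuousLinearMap.comp_apply, hDP', map_zero]
    have hDU : n₁ • dirDeriv ℓ z₀ v + fderiv ℝ lam z₀ v • g z₀ = 0 := by
      have h1 := (h.hasFDerivAt_dir.const_smul n₁).add
        (hlams.differentiableAt.hasFDerivAt.smul hgs.differentiableAt.hasFDerivAt)
      have h2 := h'.hasFDerivAt_dir.const_smul n₂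
      have h3 := DFunLike.congr_fun (h2.unique (h1.congr_of_eventuallyEq
        (by filter_upwards [hsolve] with z hz using hz.2))) v
      simpa [hv1, hDg] using h3.symm
    have h4 := congrArg (fun x => ⟪x, (ℓ z₀).dir⟫_ℝ) hDU
    simp only [inner_add_left, real_inner_smul_left, h.inner_dirDeriv, inner_zero_left, mul_zero,
      zero_add] at h4
    rw [real_inner_comm] at h4
    rw [(mul_eq_zero.1 h4).resolve_right hl0.inner_ne_zero.1, zero_smul, add_zero] at hDU
    have hDU0 := (smul_eq_zero.1 hDU).resolve_left hn₁.ne'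
    refine hi v hDU0 ?_
    rw [hDP', hDU0, smul_zero, add_zero] at hDP
    have h5 := h.inner_footDeriv v
    rw [hDU0, inner_zero_right, neg_zero, eq_neg_of_add_eq_zero_left hDP.symm, inner_neg_left,
      real_inner_smul_left, (ℓ z₀).inner_dir_self, mul_one, neg_eq_zero] at h5
    rw [h5, zero_smul, add_zero] at hDP
    exact hDP.symm
  · obtain ⟨τ, hτ, hτd⟩ := hp
    -- This is the abscissa at which the optical length counted from the incoming front is zero.
    refine ⟨fun z => ⟪P z, (ℓ' z).dir⟫_ℝ - n₁ / n₂ * (⟪P z, (ℓ z).dir⟫_ℝ - τ z),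
      hs'.sub ((smoothNear_const (n₁ / n₂) z₀).mul (hs.sub hτ)), ?_⟩
    filter_upwards [h.eventually, h'.eventually, hs.eventually_nhds, hs'.eventually_nhds,
      hτ.eventually_nhds, hτd, htan, hsolve] with z hz hz' hsz hsz' hτz hd ht hsol v
    have hsz : SmoothNear (fun y => ⟪P y, (ℓ y).dir⟫_ℝ) z := hsz
    have hsz' : SmoothNear (fun y => ⟪P y, (ℓ' y).dir⟫_ℝ) z := hsz'
    have hτz : SmoothNear τ z := hτz
    have h1 := hsz'.differentiableAt.hasFDerivAt.sub
      ((hsz.differentiableAt.hasFDerivAt.sub hτz.differentiableAt.hasFDerivAt).const_mul (n₁ / n₂))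
    have h2 : HasFDerivAt (fun z => ⟪P z, (ℓ' z).dir⟫_ℝ - n₁ / n₂ * (⟪P z, (ℓ z).dir⟫_ℝ - τ z)) _ z
      := h1
    have hDP' := congrArg (fun x => ⟪x, (ℓ' z).dir⟫_ℝ) (hz'.fderiv_point
      hsz'.differentiableAt (P := P)
      (Filter.Eventually.of_forall fun z => OrientedLine.eq_of_mem_points (hP' z)) v)
    have hDP := congrArg (fun x => ⟪x, (ℓ z).dir⟫_ℝ) (hz.fderiv_point
      hsz.differentiableAt (P := P)
      (Filter.Eventually.of_forall fun z => OrientedLine.eq_of_mem_points (hP z)) v)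
    simp only [inner_add_left, real_inner_smul_left, hz.inner_dirDeriv, hz'.inner_dirDeriv,
      OrientedLine.inner_dir_self] at hDP hDP'
    have h3 := congrArg (fun x => ⟪fderiv ℝ P z v, x⟫_ℝ) hsol.2
    simp only [inner_add_right, real_inner_smul_right] at h3
    rw [real_inner_comm (g z), ht v] at h3
    have h4 := hd v
    rw [h2.fderiv]
    simp only [sub_apply, smul_apply, smul_eq_mul]
    field_simp
    linear_combination -n₂ * hDP' + n₁ * hDP + h3 + n₁ * h4

end Step

/-! ### Families of rays parametrised by a manifold -/

theorem isLocalEquation_plane (x : Space) {u : Space} (hu : u ≠ 0) (y : Space) :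
    IsLocalEquation {y | ⟪y - x, u⟫_ℝ = 0} y (fun y => ⟪y - x, u⟫_ℝ) ∧
      ∀ v, fderiv ℝ (fun y => ⟪y - x, u⟫_ℝ) y v = ⟪v, u⟫_ℝ := by
  have hd : ∀ v, fderiv ℝ (fun y => ⟪y - x, u⟫_ℝ) y v = ⟪v, u⟫_ℝ := by
    intro v
    have h1 : HasFDerivAt (fun y => ⟪y - x, u⟫_ℝ) _ y :=
      ((hasFDerivAt_id y).sub_const x).inner ℝ (hasFDerivAt_const u y)
    rw [h1.fderiv]
    simp [fderivInnerCLM_apply]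
  refine ⟨⟨Set.univ, isOpen_univ, Set.mem_univ y, ?_, ?_, fun z _ => Iff.rfl⟩, hd⟩
  · exact ((contDiff_id.sub contDiff_const).inner ℝ contDiff_const).contDiffOn
  · intro h0
    have := hd u
    rw [h0] at this
    exact hu (inner_self_eq_zero.1 this.symm)

section Manifold

variable {M : Type*} [TopologicalSpace M] [ChartedSpace Plane M]

/-- The family `L` in the chart of `M` at `k`. -/
noncomputable def localRays (L : M → OrientedLine) (k : M) (z : Plane) : OrientedLine :=
  L ((extChartAt (𝓡 2) k).symm z)

theorem localRays_self (L : M → OrientedLine) (k : M) :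
    localRays L k (extChartAt (𝓡 2) k k) = L k := by
  rw [localRays, extChartAt_to_inv]

theorem tendsto_extChartAt_symm (k : M) :
    Filter.Tendsto (extChartAt (𝓡 2) k).symm (𝓝 (extChartAt (𝓡 2) k k)) (𝓝 k) := by
  have := continuousAt_extChartAt_symm (I := 𝓡 2) k
  rwa [ContinuousAt, extChartAt_to_inv] at this

theorem mfderiv_eq_fderiv_chart {F : Type*} [NormedAddCommGroup F] [NormedSpace ℝ F] {f : M → F}
    {k : M} (hf : MDifferentiableAt (𝓡 2) 𝓘(ℝ, F) f k) (v : Plane) :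
    mfderiv (𝓡 2) 𝓘(ℝ, F) f k v =
      fderiv ℝ (fun z => f ((extChartAt (𝓡 2) k).symm z)) (extChartAt (𝓡 2) k k) v := by
  rw [hf.mfderiv]
  simp only [ModelWithCorners.range_eq_univ, fderivWithin_univ]
  rfl

theorem SmoothRays.fderiv_coords {ℓ : Plane → OrientedLine} {z : Plane} (h : SmoothRays ℓ z)
    (v : Plane) : fderiv ℝ (fun y => (ℓ y).coords) z v = (dirDeriv ℓ z v, footDeriv ℓ z v) := by
  have : HasFDerivAt (fun y => (ℓ y).coords) _ z := h.hasFDerivAt_dir.prodMk h.hasFDerivAt_foot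
  rw [this.fderiv]
  rfl

theorem IsRegularPoint.eq_rayPoint {L : M → OrientedLine} {k : M} {x : Space}
    (h : IsRegularPoint L k x) :
    rayPoint (localRays L k) (extChartAt (𝓡 2) k k, ⟪x, (L k).dir⟫_ℝ) = x := by
  rw [rayPoint]
  simp only [localRays_self]
  exact (OrientedLine.eq_of_mem_points h.1).symm

variable [IsManifold (𝓡 2) ∞ M]

theorem smoothNear_chart {F : Type*} [NormedAddCommGroup F] [NormedSpace ℝ F] {f : M → F}
    {s : Set M} (hs : IsOpen s) (hf : ContMDiffOn (𝓡 2) 𝓘(ℝ, F) ∞ f s) {k : M} (hk : k ∈ s) :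
    SmoothNear (fun z => f ((extChartAt (𝓡 2) k).symm z)) (extChartAt (𝓡 2) k k) := by
  have h1 := hf.comp' (contMDiffOn_extChartAt_symm (I := 𝓡 2) (n := ∞) k)
  rw [contMDiffOn_iff_contDiffOn] at h1
  have h2 : ∀ᶠ z in 𝓝 (extChartAt (𝓡 2) k k), z ∈ (extChartAt (𝓡 2) k).target ∩
      (extChartAt (𝓡 2) k).symm ⁻¹' s :=
    Filter.Eventually.and (extChartAt_target_mem_nhds k)
      ((tendsto_extChartAt_symm k).eventually (hs.mem_nhds hk))
  filter_upwards [h2.eventually_nhds] with z hz using h1.contDiffAt hz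

/-- Every `k` is the base point of its own preferred chart, in which `mfderiv` at `k` is an ordinary
derivative; testing there suffices. -/
theorem isRayFamily_iff {L : M → OrientedLine} : IsRayFamily 2 L ↔
    ∀ k, SmoothRays (localRays L k) (extChartAt (𝓡 2) k k) ∧
      ∀ v, dirDeriv (localRays L k) (extChartAt (𝓡 2) k k) v = 0 →
        footDeriv (localRays L k) (extChartAt (𝓡 2) k k) v = 0 → v = 0 := by
  have key : ∀ k, SmoothRays (localRays L k) (extChartAt (𝓡 2) k k) →
      MDifferentiableAt (𝓡 2) 𝓘(ℝ, Space × Space) (fun k => (L k).coords) k →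
      (Function.Injective (mfderiv (𝓡 2) 𝓘(ℝ, Space × Space) (fun k => (L k).coords) k) ↔
      ∀ v, dirDeriv (localRays L k) (extChartAt (𝓡 2) k k) v = 0 →
        footDeriv (localRays L k) (extChartAt (𝓡 2) k k) v = 0 → v = 0) := by
    intro k hk hd
    rw [injective_iff_map_eq_zero]
    have h1 : ∀ v : Plane, mfderiv (𝓡 2) 𝓘(ℝ, Space × Space) (fun k => (L k).coords) k v =
        (dirDeriv (localRays L k) (extChartAt (𝓡 2) k k) v,
          footDeriv (localRays L k) (extChartAt (𝓡 2) k k) v) := fun v =>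
      (mfderiv_eq_fderiv_chart hd v).trans (hk.fderiv_coords v)
    constructor
    · intro h v hv1 hv2
      exact h v ((h1 v).trans (by rw [hv1, hv2]; rfl))
    · intro h v hv
      have h2 := (h1 v).symm.trans hv
      exact h v (congrArg Prod.fst h2) (congrArg Prod.snd h2)
  constructor
  · rintro ⟨h1, h2⟩ k
    have h3 := smoothNear_chart isOpen_univ h1.contMDiffOn (Set.mem_univ k)
    have h4 : SmoothRays (localRays L k) (extChartAt (𝓡 2) k k) :=
      ⟨by filter_upwards [h3] with z hz using hz.fst, by filter_upwards [h3] with z hz using hz.snd⟩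
    exact ⟨h4, (key k h4 ((h1 k).mdifferentiableAt (by simp))).1 (h2 k)⟩
  · intro h
    have h1 : ContMDiff (𝓡 2) 𝓘(ℝ, Space × Space) ∞ (fun k => (L k).coords) := by
      intro k
      have h2 : ContDiffAt ℝ ∞ (fun z => (localRays L k z).coords) (extChartAt (𝓡 2) k k) :=
        (h k).1.dir.contDiffAt.prodMk (h k).1.foot.contDiffAt
      have h3 := h2.contMDiffAt.comp k (contMDiffAt_extChartAt (I := 𝓡 2) (n := ∞) (x := k))
      refine h3.congr_of_eventuallyEq ?_
      filter_upwards [extChartAt_source_mem_nhds (I := 𝓡 2) k] with l hl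
      simp only [Function.comp, localRays, (extChartAt (𝓡 2) k).left_inv hl]
    exact ⟨h1, fun k => (key k (h k).1 ((h1 k).mdifferentiableAt (by simp))).2 (h k).2⟩

/-! ### Regular points are the non-focal points -/

/-- A surface transverse to a ray at a regular point is a local section of the family, here written
in a chart. -/
theorem IsRegularPoint.exists_section {L : M → OrientedLine} {k : M} {x : Space}
    (h : IsRegularPoint L k x) {S : Set Space} (hS : IsSmoothSurface S) (hx : x ∈ S)
    (ht : (L k).dir ∉ tangentPlane S x) :
    ∃ e : Plane → Space, SmoothNear e (extChartAt (𝓡 2) k k) ∧ e (extChartAt (𝓡 2) k k) = x ∧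
      (∀ᶠ z in 𝓝 (extChartAt (𝓡 2) k k), e z ∈ (localRays L k z).points ∩ S) ∧
      ∀ v, fderiv ℝ e (extChartAt (𝓡 2) k k) v = 0 → v = 0 := by
  obtain ⟨e, heo, hk, ⟨W, -, hW⟩, hxe, hpt, he, hes⟩ := h.2 S hS hx ht
  have hek : e k = x := by
    have h1 : x ∈ (L k).points ∩ e.target := ⟨h.1, hxe⟩
    rw [hpt k hk] at h1
    exact h1.symm
  have hsm := smoothNear_chart heo he hk
  refine ⟨fun z => e ((extChartAt (𝓡 2) k).symm z), hsm, by simp [hek], ?_, ?_⟩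
  · filter_upwards [(tendsto_extChartAt_symm k).eventually (heo.mem_nhds hk)] with z hz
    have h1 : e ((extChartAt (𝓡 2) k).symm z) ∈
        (L ((extChartAt (𝓡 2) k).symm z)).points ∩ e.target := by
      rw [hpt _ hz]; rfl
    exact ⟨h1.1, (hW ▸ h1.2 : _ ∈ S ∩ W).1⟩
  · intro v hv
    have hd : MDifferentiableAt (𝓡 2) 𝓘(ℝ, Space) e k :=
      (he.contMDiffAt (heo.mem_nhds hk)).mdifferentiableAt (by simp)
    have h1 : mfderiv (𝓡 2) 𝓘(ℝ, Space) e k v = 0 := (mfderiv_eq_fderiv_chart hd v).trans hv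
    -- The target lies in a surface, so the derivative of `e.symm` within it is not unique in space.
    -- Any choice is a left inverse of the derivative of `e`, because `e` maps its open source into
    -- the target.
    have h2 : MDifferentiableWithinAt 𝓘(ℝ, Space) (𝓡 2) e.symm e.target (e k) :=
      (hes (e k) (e.map_source hk)).mdifferentiableWithinAt (by simp)
    have h3 := h2.hasMFDerivWithinAt.comp k (hd.hasMFDerivAt.hasMFDerivWithinAt (s := e.source))
      fun l hl => e.map_source hl
    have h4 := h3.hasMFDerivAt (heo.mem_nhds hk)
    have h5 : HasMFDerivAt (𝓡 2) (𝓡 2) (e.symm ∘ e) k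
        (ContinuousLinearMap.id ℝ (TangentSpace (𝓡 2) k)) := by
      refine (hasMFDerivAt_id k).congr_of_eventuallyEq ?_
      filter_upwards [heo.mem_nhds hk] with l hl using e.left_inv hl
    have h6 := DFunLike.congr_fun (hasMFDerivAt_unique h5 h4) v
    have h7 : v = mfderivWithin 𝓘(ℝ, Space) (𝓡 2) e.symm e.target (e k)
      (mfderiv (𝓡 2) 𝓘(ℝ, Space) e k v) := h6
    rw [h7, h1]
    exact map_zero _

/-- Regularity is tested on one surface only, the plane through `x` orthogonal to the ray. -/
theorem IsRegularPoint.nonfocal {L : M → OrientedLine} {k : M} {x : Space}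
    (h : IsRegularPoint L k x) (hL : SmoothRays (localRays L k) (extChartAt (𝓡 2) k k)) :
    Nonfocal (localRays L k) (extChartAt (𝓡 2) k k) ⟪x, (L k).dir⟫_ℝ := by
  have hpl := isLocalEquation_plane x (L k).dir_ne_zero
  set S : Set Space := {y | ⟪y - x, (L k).dir⟫_ℝ = 0} with hS
  have hxS : x ∈ S := by simp [hS]
  obtain ⟨e, he, hex, hm, hi⟩ := h.exists_section (S := S) (fun y _ => ⟨_, (hpl y).1⟩) hxS (by
    rw [(hpl x).1.mem_tangentPlane_iff hxS, (hpl x).2, (L k).inner_dir_self]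
    exact one_ne_zero)
  have h1 := hL.nonfocal_of_section he (by filter_upwards [hm] with z hz using hz.1)
    (by
      filter_upwards [hm] with z hz
      rw [hex, localRays_self]
      exact hz.2) hi
  rwa [hex, localRays_self] at h1

theorem Nonfocal.isRegularPoint {L : M → OrientedLine} {k : M} {t : ℝ}
    (hL : SmoothRays (localRays L k) (extChartAt (𝓡 2) k k))
    (hn : Nonfocal (localRays L k) (extChartAt (𝓡 2) k k) t) :
    IsRegularPoint L k (rayPoint (localRays L k) (extChartAt (𝓡 2) k k, t)) := by
  have hmem := rayPoint_mem_points (localRays L k) (extChartAt (𝓡 2) k k) t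
  rw [localRays_self] at hmem
  refine ⟨hmem, fun S hS hx ht => ?_⟩
  rw [← localRays_self L k] at ht
  obtain ⟨e, G, A, W, hA, hW, hzA, hAO, hez, he, hG, heS, hGS, hpt⟩ :=
    hL.exists_section hn hS hx ht (extChartAt_target_mem_nhds k)
  set φ := extChartAt (𝓡 2) k with hφ
  have hsrc : IsOpen (φ.source ∩ φ ⁻¹' A) := isOpen_extChartAt_preimage' k hA
  have hG' : ∀ y ∈ S ∩ W, φ.symm (G y) ∈ φ.source ∩ φ ⁻¹' A := by
    intro y hy
    have h1 := (hGS y hy).1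
    refine ⟨φ.map_target (hAO h1), ?_⟩
    rw [Set.mem_preimage, φ.right_inv (hAO h1)]
    exact h1
  refine ⟨⟨fun l => e (φ l), fun y => φ.symm (G y), φ.source ∩ φ ⁻¹' A, S ∩ W,
    fun l hl => (heS _ hl.2).1, hG', fun l hl => ?_, fun y hy => ?_⟩, hsrc,
    ⟨mem_extChartAt_source k, hzA⟩, ⟨W, hW, rfl⟩, hez ▸ (heS _ hzA).1, fun l hl => ?_, ?_, ?_⟩
  · rw [(heS _ hl.2).2, φ.left_inv hl.1]
  · rw [φ.right_inv (hAO (hGS y hy).1), (hGS y hy).2]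
  · have h1 := hpt _ hl.2
    rwa [localRays, φ.left_inv hl.1] at h1
  · intro l hl
    have h1 := (he _ hl.2).contMDiffAt.comp l (contMDiffAt_extChartAt' (I := 𝓡 2) (n := ∞)
      (by simpa [hφ] using hl.1))
    exact h1.contMDiffWithinAt
  · intro y hy
    have h1 : ContMDiffAt 𝓘(ℝ, Plane) (𝓡 2) ∞ φ.symm (G y) :=
      (contMDiffOn_extChartAt_symm k).contMDiffAt
        ((isOpen_extChartAt_target k).mem_nhds (hAO (hGS y hy).1))
    exact (h1.comp y (hG y hy.2).contMDiffAt).contMDiffWithinAt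

/-- The orthogonal surface is transverse to the ray, so regularity of `x` makes the crossing point
move smoothly. -/
theorem IsRectangular.hasPotential {L : M → OrientedLine} (h : IsRectangular L) {k : M} {x : Space}
    (hx : IsRegularPoint L k x) (hL : SmoothRays (localRays L k) (extChartAt (𝓡 2) k k)) :
    HasPotential (localRays L k) (extChartAt (𝓡 2) k k) := by
  obtain ⟨S, hS, hxS, hcross⟩ := h k x hx
  have ht : (L k).dir ∉ tangentPlane S x := fun h0 => by
    have h1 := hcross.self_of_nhds.2 x ⟨hx.1, hxS⟩ _ h0
    rw [(L k).inner_dir_self] at h1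
    exact one_ne_zero h1
  obtain ⟨e, he, -, hm, -⟩ := hx.exists_section hS hxS ht
  exact hL.hasPotential_of_crossesOrthogonally he hm ((tendsto_extChartAt_symm k).eventually hcross)

theorem isRectangular_of_hasPotential {L : M → OrientedLine}
    (hL : ∀ k, SmoothRays (localRays L k) (extChartAt (𝓡 2) k k))
    (hp : ∀ k, HasPotential (localRays L k) (extChartAt (𝓡 2) k k)) : IsRectangular L := by
  intro k x hx
  obtain ⟨S, hS, hxS, hcross⟩ := (hL k).exists_wavefront (hx.nonfocal (hL k)) (hp k)
  refine ⟨S, hS, hx.eq_rayPoint ▸ hxS, ?_⟩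
  filter_upwards [(continuousAt_extChartAt (I := 𝓡 2) k).eventually hcross,
    extChartAt_source_mem_nhds (I := 𝓡 2) k] with l hl hls
  rwa [localRays, (extChartAt (𝓡 2) k).left_inv hls] at hl

/-- Reflection and refraction preserve the families with a potential. -/
theorem Propagates.isRayFamily_and_hasPotential {N : ℕ} {sys : OpticalSystem N}
    {ray : Fin (N + 1) → M → OrientedLine} {hit : Fin N → M → Space}
    (hprop : Propagates sys ray hit) (h0 : IsRayFamily 2 (ray 0))
    (hp0 : ∀ k, HasPotential (localRays (ray 0) k) (extChartAt (𝓡 2) k k)) (i : Fin (N + 1)) :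
    IsRayFamily 2 (ray i) ∧
      ∀ k, HasPotential (localRays (ray i) k) (extChartAt (𝓡 2) k k) := by
  induction i using Fin.induction with
  | zero => exact ⟨h0, hp0⟩
  | succ i ih =>
    obtain ⟨hf, hp⟩ := ih
    rw [isRayFamily_iff] at hf ⊢
    obtain ⟨κ, hκ, hlaw⟩ := sys.exists_deviationLaw i
    -- The inverse chart is a total map into `M`, so the incidences and the law hold for all `z`,
    -- even off the chart target.
    have key := fun k => (hf k).1.deviate (ℓ' := localRays (ray i.succ) k)
      (P := fun z => hit i ((extChartAt (𝓡 2) k).symm z)) (hf k).2 (hp k) hκ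
      (sys.index_pos _) (sys.index_pos _) (sys.smooth_surface i)
      (fun z => hprop.hit_mem_surface i _)
      ((hprop.continuous_hit i).continuousAt.comp (continuousAt_extChartAt_symm k))
      (fun z => hprop.hit_mem_incoming i _) (fun z => hprop.hit_mem_outgoing i _)
      (fun z => by
        obtain ⟨ν, hν, hl⟩ := hprop.law i ((extChartAt (𝓡 2) k).symm z)
        exact ⟨ν, hν, hlaw _ _ _ hν.1 hl⟩)
    exact ⟨fun k => ⟨(key k).1, (key k).2.1⟩, fun k => (key k).2.2⟩

end Manifold

end MalusDupin

theorem mainTheorem1 {M : Type*} [TopologicalSpace M] [ChartedSpace (EuclideanSpace ℝ (Fin 2)) M]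
    [IsManifold (𝓡 2) ∞ M] {N : ℕ} (sys : MalusDupin.OpticalSystem N)
    (ray : Fin (N + 1) → M → MalusDupin.OrientedLine) (hit : Fin N → M → MalusDupin.Space)
    (hfamily : MalusDupin.IsRayFamily 2 (ray 0))
    (hregular : ∀ k : M, ∃ x : MalusDupin.Space, MalusDupin.IsRegularPoint (ray 0) k x)
    (hrect : MalusDupin.IsRectangular (ray 0))
    (hprop : MalusDupin.Propagates sys ray hit) :
    ∀ i : Fin (N + 1),
      MalusDupin.IsRayFamily 2 (ray i) ∧
      (∀ k : M, ∃ x : MalusDupin.Space, MalusDupin.IsRegularPoint (ray i) k x) ∧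
      MalusDupin.IsRectangular (ray i) := by
  intro i
  have h0 := MalusDupin.isRayFamily_iff.1 hfamily
  obtain ⟨hf, hp⟩ := hprop.isRayFamily_and_hasPotential hfamily (fun k => by
    obtain ⟨x, hx⟩ := hregular k
    exact hrect.hasPotential hx (h0 k).1) i
  have hs := MalusDupin.isRayFamily_iff.1 hf
  refine ⟨hf, fun k => ?_, MalusDupin.isRectangular_of_hasPotential (fun k => (hs k).1) hp⟩
  obtain ⟨t, ht⟩ := (hs k).1.exists_nonfocal (hp k) (hs k).2
  exact ⟨_, ht.isRegularPoint (hs k).1⟩
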